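/- Let $d\ge 1$. Let $K$ be a (strictly) positive-definite function on a domain $\mathcal D\subset\mathbb R^d$ and let $\tau>0$. Let $\mathbf s_1,\dots,\mathbf s_\ell\in\mathcal D$ enumerate an equidistant grid in a $d$-dimensional hypercube (the same number $\ell^{1/d}$ of values and the same spacing in each coordinate), ordered so that one fixed spatial coordinate is nondecreasing along the enumeration (ties are broken arbitrarily; the lexicographic order is a special case). Let $y_i=y(\mathbf s_i)$ for a centered Gaussian process $y$ with covariance function $K$, and $z_i=y_i+\varepsilon_i$ with independent $\varepsilon_i\sim\mathcal N(0,\tau^2)$ for $i=1,\dots,\ell$. Let $\mathbf x=(y_1,z_1,\dots,y_\ell,z_\ell)$, $n=2\ell$, and let $C$ be the covariance of $\mathbf x$. Let $1\le m\le \ell^{1/d}$, and let $q(i)$ consist of the $\min(m,i-1)$ indices $j<i$ whose locations are nearest to $\mathbf s_i$ in Euclidean distance (ties are broken arbitrarily). In the latent Vecchia approximation $y_i$ is conditioned on $(y_j)_{j\in q(i)}$ and $z_i$ on $y_i$. With $g(x)$ the vector of conditioning variables of a component $x$ of $\mathbf x$, put $B_x=C(x,g(x))\,C(g(x),g(x))^{-1}$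 and $D_x=C(x,x)-B_x\,C(g(x),x)$. Let $\mathbf U$ be the matrix indexed by the components of $\mathbf x$ with $\mathbf U_{xx}=D_x^{-1/2}$, $\mathbf U_{wx}=-(B_x)_w D_x^{-1/2}$ for $w$ in $g(x)$, and all other elements zero. Let $\mathbf U_Y$ consist of the rows of $\mathbf U$ that belong to $y_1,\dots,y_\ell$, let $\mathbf W=\mathbf U_Y\mathbf U_Y'$, and let $\mathbf V=\mathrm{rchol}(\mathbf W)=\mathbf P\,\mathrm{chol}(\mathbf P\mathbf W\mathbf P)\,\mathbf P$, where $\mathrm{chol}$ is the lower-triangular Cholesky factor with positive diagonal and $\mathbf P$ is the permutation matrix that reverses the order. Then $\mathbf V$ is upper triangular with positive diagonal, $\mathbf V\mathbf V'=\mathbf W$, and, with constants in the $\mathcal O$ terms that depend only on $d$: (i) each column of $\mathbf V$ has $\mathcal O(n^{1-1/d}m^{1/d})$ nonzero elements; (ii) $\mathbf V$ has $\mathcal O(n^{2-1/d}m^{1/d})$ nonzero elements in total, and $\mathbf V$ can be computed from $\mathbf W$ with $\mathcal O(n^{2-1/d}m^{1/d})$ memory; (iii) the same computation takes time $\mathcal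 O(n^{3-2/d}m^{2/d})$. In (ii) and (iii), a single program (independent of $d$, $m$, $K$, $\tau$ and the grid) on a random access machine with exact real arithmetic and square roots at unit cost, whose addresses and index values are bounded by the memory bound, reads $\ell$ and the list of positions and values of the nonzero elements of $\mathbf W$ in any order and returns the corresponding list for $\mathbf V$. -/

import Mathlib

/-! ## Reverse Cholesky factor -/

namespace Vecchia

/-- `L` is a lower-triangular Cholesky factor of `A`: lower triangular, positive diagonal,
`L Lᵀ = A`. -/
def IsCholeskyFactor {ℓ : ℕ} (A L : Matrix (Fin ℓ) (Fin ℓ) ℝ) : Prop :=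
  (∀ i j, i < j → L i j = 0) ∧ (∀ i, 0 < L i i) ∧ L * L.transpose = A

open Classical in
/-- The lower-triangular Cholesky factor (which exists and is unique for a symmetric positive
definite matrix; junk value `0` if there is none). -/
noncomputable def chol {ℓ : ℕ} (A : Matrix (Fin ℓ) (Fin ℓ) ℝ) : Matrix (Fin ℓ) (Fin ℓ) ℝ :=
  if h : ∃ L, IsCholeskyFactor A L then h.choose else 0

/-- `P A P`, where `P` is the permutation matrix that reverses the order of the rows. -/
def rev {ℓ : ℕ} (A : Matrix (Fin ℓ) (Fin ℓ) ℝ) : Matrix (Fin ℓ) (Fin ℓ) ℝ :=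
  A.submatrix Fin.rev Fin.rev

/-- The reverse Cholesky factor `rchol(A) = P chol(P A P) P`. -/
noncomputable def rchol {ℓ : ℕ} (A : Matrix (Fin ℓ) (Fin ℓ) ℝ) : Matrix (Fin ℓ) (Fin ℓ) ℝ :=
  rev (chol (rev A))

/-! ## Covariance functions, grids, coordinate ordering, nearest-neighbor conditioning -/

/-- `K` is a (strictly) positive-definite function on the domain `D`: its Gram matrix at any
finitely many distinct points of `D` is symmetric positive definite. -/
def IsPosDefKernel {d : ℕ} (D : Set (EuclideanSpace ℝ (Fin d)))
    (K : EuclideanSpace ℝ (Fin d) → EuclideanSpace ℝ (Fin d) → ℝ) : Prop :=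
  ∀ (k : ℕ) (p : Fin k → EuclideanSpace ℝ (Fin d)), Function.Injective p → (∀ i, p i ∈ D) →
    (Matrix.of fun i j => K (p i) (p j)).PosDef

/-- The locations `S 0, …, S (ℓ - 1)` enumerate, in some order and without repetition, an
equidistant grid in a `d`-dimensional hypercube: `N` values in each coordinate, with the same
spacing `h > 0` in all coordinates. -/
def IsEquidistantGrid {d ℓ : ℕ} (S : Fin ℓ → EuclideanSpace ℝ (Fin d)) : Prop :=
  ∃ (N : ℕ) (a : EuclideanSpace ℝ (Fin d)) (h : ℝ) (e : Fin ℓ ≃ (Fin d → Fin N)),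
    0 < h ∧ ∀ i k, S i k = a k + h * ((e i k : ℕ) : ℝ)

/-- The locations are ordered along one of the spatial coordinates. Ties may be broken in any
way; the lexicographic order is a special case. -/
def IsCoordOrdered {d ℓ : ℕ} (S : Fin ℓ → EuclideanSpace ℝ (Fin d)) : Prop :=
  ∃ c : Fin d, ∀ i j, i < j → S i c ≤ S j c

/-- `q i` consists of the `m` nearest predecessors of location `i` (of all the predecessors if
there are fewer than `m`), for the Euclidean distance, ties being broken in any way. -/
def IsNearestNeighborConditioning {d ℓ : ℕ} (S : Fin ℓ → EuclideanSpace ℝ (Fin d)) (m : ℕ)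
    (q : Fin ℓ → Finset (Fin ℓ)) : Prop :=
  ∀ i, (∀ j ∈ q i, j < i) ∧ (q i).card = min m (i : ℕ) ∧
    ∀ j ∈ q i, ∀ k, k < i → k ∉ q i → dist (S i) (S j) ≤ dist (S i) (S k)

/-! ## The latent Vecchia approximation with singleton blocks, all locations observed

The vector `x` consists of the latent variables `y i` (index `Sum.inl i`) and of the
observations `z i = y i + ε i` (index `Sum.inr i`). -/

/-- The covariance matrix `C` of `x`, for the covariance function `K` and the noise variance
`τ ^ 2`. -/
def covX {d ℓ : ℕ} (K : EuclideanSpace ℝ (Fin d) → EuclideanSpace ℝ (Fin d) → ℝ) (τ : ℝ)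
    (S : Fin ℓ → EuclideanSpace ℝ (Fin d)) : Matrix (Fin ℓ ⊕ Fin ℓ) (Fin ℓ ⊕ Fin ℓ) ℝ
  | .inl i, .inl j => K (S i) (S j)
  | .inl i, .inr j => K (S i) (S j)
  | .inr i, .inl j => K (S i) (S j)
  | .inr i, .inr j => K (S i) (S j) + if i = j then τ ^ 2 else 0

/-- Latent Vecchia: `y i` conditions on the latent `y j`, `j ∈ q i`, and `z i` on `y i`. -/
def parents {ℓ : ℕ} (q : Fin ℓ → Finset (Fin ℓ)) : Fin ℓ ⊕ Fin ℓ → Finset (Fin ℓ ⊕ Fin ℓ)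
  | .inl i => (q i).map Function.Embedding.inl
  | .inr i => {Sum.inl i}

/-- `B_x = C(x, g) C(g, g)⁻¹` for the conditioning set `g` of the variable `x`. -/
noncomputable def coefB {d ℓ : ℕ}
    (K : EuclideanSpace ℝ (Fin d) → EuclideanSpace ℝ (Fin d) → ℝ) (τ : ℝ)
    (S : Fin ℓ → EuclideanSpace ℝ (Fin d)) (q : Fin ℓ → Finset (Fin ℓ)) (x : Fin ℓ ⊕ Fin ℓ)
    (w : {w // w ∈ parents q x}) : ℝ :=
  ∑ v : {v // v ∈ parents q x}, covX K τ S x v *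
    ((covX K τ S).submatrix (fun u : {u // u ∈ parents q x} => (u : Fin ℓ ⊕ Fin ℓ))
      (fun u : {u // u ∈ parents q x} => (u : Fin ℓ ⊕ Fin ℓ)))⁻¹ v w

/-- `D_x = C(x, x) - B_x C(g, x)` for the conditioning set `g` of the variable `x`. -/
noncomputable def condVar {d ℓ : ℕ}
    (K : EuclideanSpace ℝ (Fin d) → EuclideanSpace ℝ (Fin d) → ℝ) (τ : ℝ)
    (S : Fin ℓ → EuclideanSpace ℝ (Fin d)) (q : Fin ℓ → Finset (Fin ℓ)) (x : Fin ℓ ⊕ Fin ℓ) : ℝ :=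
  covX K τ S x x - ∑ w : {w // w ∈ parents q x}, coefB K τ S q x w * covX K τ S w x

/-- The matrix `U`, with `U Uᵀ` the precision matrix of the Vecchia approximation of the law of
`x`; it is upper triangular for the order `y 0, z 0, y 1, z 1, …`. -/
noncomputable def matU {d ℓ : ℕ}
    (K : EuclideanSpace ℝ (Fin d) → EuclideanSpace ℝ (Fin d) → ℝ) (τ : ℝ)
    (S : Fin ℓ → EuclideanSpace ℝ (Fin d)) (q : Fin ℓ → Finset (Fin ℓ)) :
    Matrix (Fin ℓ ⊕ Fin ℓ) (Fin ℓ ⊕ Fin ℓ) ℝ := fun w x =>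
  if w = x then (Real.sqrt (condVar K τ S q x))⁻¹
  else if h : w ∈ parents q x then
    -(coefB K τ S q x ⟨w, h⟩) * (Real.sqrt (condVar K τ S q x))⁻¹
  else 0

/-- `U_Y`, the rows of `U` that correspond to the latent variables. -/
noncomputable def matUY {d ℓ : ℕ}
    (K : EuclideanSpace ℝ (Fin d) → EuclideanSpace ℝ (Fin d) → ℝ) (τ : ℝ)
    (S : Fin ℓ → EuclideanSpace ℝ (Fin d)) (q : Fin ℓ → Finset (Fin ℓ)) :
    Matrix (Fin ℓ) (Fin ℓ ⊕ Fin ℓ) ℝ :=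
  (matU K τ S q).submatrix Sum.inl id

/-- `W = U_Y U_Yᵀ`. -/
noncomputable def matW {d ℓ : ℕ}
    (K : EuclideanSpace ℝ (Fin d) → EuclideanSpace ℝ (Fin d) → ℝ) (τ : ℝ)
    (S : Fin ℓ → EuclideanSpace ℝ (Fin d)) (q : Fin ℓ → Finset (Fin ℓ)) :
    Matrix (Fin ℓ) (Fin ℓ) ℝ :=
  matUY K τ S q * (matUY K τ S q).transpose

/-- `V = rchol(W)`. -/
noncomputable def matV {d ℓ : ℕ}
    (K : EuclideanSpace ℝ (Fin d) → EuclideanSpace ℝ (Fin d) → ℝ) (τ : ℝ)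
    (S : Fin ℓ → EuclideanSpace ℝ (Fin d)) (q : Fin ℓ → Finset (Fin ℓ)) :
    Matrix (Fin ℓ) (Fin ℓ) ℝ :=
  rchol (matW K τ S q)

end Vecchia

/-! ## A random access machine over the reals

Programs are finite while-programs over natural-number (index) variables and arrays and real
variables and arrays. Every variable access, array access, constant, arithmetic operation
(square roots included), comparison and assignment costs one unit of time. A program is run with
a memory bound `M`: all array addresses and all index values that occur must be at most `M`, so
that at most `M + 1` cells of each of the finitely many arrays named in the program are used. -/

namespace RealRAM

/-- The contents of the memory. -/
structure State where
  ivar : ℕ → ℕ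
  rvar : ℕ → ℝ
  iarr : ℕ → ℕ → ℕ
  rarr : ℕ → ℕ → ℝ

namespace State

/-- Assign a value to an index variable. -/
def setI (s : State) (x n : ℕ) : State :=
  { s with ivar := Function.update s.ivar x n }

/-- Assign a value to a real variable. -/
def setR (s : State) (x : ℕ) (u : ℝ) : State :=
  { s with rvar := Function.update s.rvar x u }

/-- Write the index value `n` into cell `k` of the index array `a`. -/
def writeI (s : State) (a k n : ℕ) : State :=
  { s with iarr := Function.update s.iarr a (Function.update (s.iarr a) k n) }

/-- Write the real value `u` into cell `k` of the real array `a`. -/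
def writeR (s : State) (a k : ℕ) (u : ℝ) : State :=
  { s with rarr := Function.update s.rarr a (Function.update (s.rarr a) k u) }

end State

/-- Index expressions; `sub` is truncated subtraction. -/
inductive IExpr where
  | const (c : ℕ)
  | var (x : ℕ)
  | read (a : ℕ) (e : IExpr)
  | add (e f : IExpr)
  | sub (e f : IExpr)
  | mul (e f : IExpr)

/-- Real expressions; the only constants are integers. -/
inductive RExpr where
  | const (c : ℤ)
  | var (x : ℕ)
  | read (a : ℕ) (e : IExpr)
  | add (e f : RExpr)
  | sub (e f : RExpr)
  | mul (e f : RExpr)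
  | div (e f : RExpr)
  | sqrt (e : RExpr)

/-- Tests. -/
inductive Test where
  | ilt (e f : IExpr)
  | rlt (e f : RExpr)
  | req (e f : RExpr)

/-- Programs. -/
inductive Prog where
  | skip
  | iset (x : ℕ) (e : IExpr)
  | rset (x : ℕ) (e : RExpr)
  | iwrite (a : ℕ) (e f : IExpr)
  | rwrite (a : ℕ) (e : IExpr) (f : RExpr)
  | seq (p q : Prog)
  | ite (b : Test) (p q : Prog)
  | loop (b : Test) (p : Prog)

namespace IExpr

/-- The value of an index expression. -/
def eval (s : State) : IExpr → ℕ
  | const c => c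
  | var x => s.ivar x
  | read a e => s.iarr a (e.eval s)
  | add e f => e.eval s + f.eval s
  | sub e f => e.eval s - f.eval s
  | mul e f => e.eval s * f.eval s

/-- All the values that occur in the evaluation are at most `M`. -/
def Ok (M : ℕ) (s : State) : IExpr → Prop
  | const c => c ≤ M
  | var x => s.ivar x ≤ M
  | read a e => e.Ok M s ∧ s.iarr a (e.eval s) ≤ M
  | add e f => e.Ok M s ∧ f.Ok M s ∧ e.eval s + f.eval s ≤ M
  | sub e f => e.Ok M s ∧ f.Ok M s
  | mul e f => e.Ok M s ∧ f.Ok M s ∧ e.eval s * f.eval s ≤ M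

/-- The time that the evaluation takes. -/
def cost : IExpr → ℕ
  | const _ => 1
  | var _ => 1
  | read _ e => e.cost + 1
  | add e f => e.cost + f.cost + 1
  | sub e f => e.cost + f.cost + 1
  | mul e f => e.cost + f.cost + 1

end IExpr

namespace RExpr

/-- The value of a real expression. -/
noncomputable def eval (s : State) : RExpr → ℝ
  | const c => (c : ℝ)
  | var x => s.rvar x
  | read a e => s.rarr a (e.eval s)
  | add e f => e.eval s + f.eval s
  | sub e f => e.eval s - f.eval s
  | mul e f => e.eval s * f.eval s
  | div e f => e.eval s / f.eval s
  | sqrt e => Real.sqrt (e.eval s)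

/-- All addresses that occur in the evaluation are at most `M`, no division by zero and no root
of a negative number occurs. -/
def Ok (M : ℕ) (s : State) : RExpr → Prop
  | const _ => True
  | var _ => True
  | read _ e => e.Ok M s
  | add e f => e.Ok M s ∧ f.Ok M s
  | sub e f => e.Ok M s ∧ f.Ok M s
  | mul e f => e.Ok M s ∧ f.Ok M s
  | div e f => e.Ok M s ∧ f.Ok M s ∧ f.eval s ≠ 0
  | sqrt e => e.Ok M s ∧ 0 ≤ e.eval s

/-- The time that the evaluation takes. -/
def cost : RExpr → ℕ
  | const _ => 1
  | var _ => 1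
  | read _ e => e.cost + 1
  | add e f => e.cost + f.cost + 1
  | sub e f => e.cost + f.cost + 1
  | mul e f => e.cost + f.cost + 1
  | div e f => e.cost + f.cost + 1
  | sqrt e => e.cost + 1

end RExpr

namespace Test

/-- The test succeeds. -/
def Holds (s : State) : Test → Prop
  | ilt e f => e.eval s < f.eval s
  | rlt e f => e.eval s < f.eval s
  | req e f => e.eval s = f.eval s

/-- The expressions in the test can be evaluated. -/
def Ok (M : ℕ) (s : State) : Test → Prop
  | ilt e f => e.Ok M s ∧ f.Ok M s
  | rlt e f => e.Ok M s ∧ f.Ok M s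
  | req e f => e.Ok M s ∧ f.Ok M s

/-- The time that the test takes. -/
def cost : Test → ℕ
  | ilt e f => e.cost + f.cost + 1
  | rlt e f => e.cost + f.cost + 1
  | req e f => e.cost + f.cost + 1

end Test

/-- `Exec M p s s' t`: with memory bound `M`, the program `p`, started in the state `s`, halts
in the state `s'` after time `t`. -/
inductive Exec (M : ℕ) : Prog → State → State → ℕ → Prop
  | skip (s : State) : Exec M .skip s s 0
  | iset (s : State) (x : ℕ) (e : IExpr) (he : e.Ok M s) :
      Exec M (.iset x e) s (s.setI x (e.eval s)) (e.cost + 1)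
  | rset (s : State) (x : ℕ) (e : RExpr) (he : e.Ok M s) :
      Exec M (.rset x e) s (s.setR x (e.eval s)) (e.cost + 1)
  | iwrite (s : State) (a : ℕ) (e f : IExpr) (he : e.Ok M s) (hf : f.Ok M s) :
      Exec M (.iwrite a e f) s
        (s.writeI a (e.eval s) (f.eval s))
        (e.cost + f.cost + 1)
  | rwrite (s : State) (a : ℕ) (e : IExpr) (f : RExpr) (he : e.Ok M s) (hf : f.Ok M s) :
      Exec M (.rwrite a e f) s
        (s.writeR a (e.eval s) (f.eval s))
        (e.cost + f.cost + 1)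
  | seq (p q : Prog) (s s' s'' : State) (t t' : ℕ) (hp : Exec M p s s' t)
      (hq : Exec M q s' s'' t') : Exec M (.seq p q) s s'' (t + t')
  | ite_true (b : Test) (p q : Prog) (s s' : State) (t : ℕ) (hb : b.Ok M s) (h : b.Holds s)
      (hp : Exec M p s s' t) : Exec M (.ite b p q) s s' (b.cost + t)
  | ite_false (b : Test) (p q : Prog) (s s' : State) (t : ℕ) (hb : b.Ok M s) (h : ¬ b.Holds s)
      (hq : Exec M q s s' t) : Exec M (.ite b p q) s s' (b.cost + t)
  | loop_false (b : Test) (p : Prog) (s : State) (hb : b.Ok M s) (h : ¬ b.Holds s) :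
      Exec M (.loop b p) s s b.cost
  | loop_true (b : Test) (p : Prog) (s s' s'' : State) (t t' : ℕ) (hb : b.Ok M s)
      (h : b.Holds s) (hp : Exec M p s s' t) (hl : Exec M (.loop b p) s' s'' t') :
      Exec M (.loop b p) s s'' (b.cost + t + t')

/-- The state `s` holds the sparse matrix `A` as the list (in any order) of the positions and
values of its nonzero elements: the index variable `x` contains their number, the index arrays
`r` and `c` their row and column numbers, and the real array `v` their values. -/
def StoresSparse {ℓ : ℕ} (s : State) (x r c v : ℕ) (A : Matrix (Fin ℓ) (Fin ℓ) ℝ) : Prop :=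
  (∀ p < s.ivar x, ∃ i j : Fin ℓ,
    s.iarr r p = i ∧ s.iarr c p = j ∧ s.rarr v p = A i j ∧ A i j ≠ 0) ∧
  ∀ i j : Fin ℓ, A i j ≠ 0 → ∃! p, p < s.ivar x ∧ s.iarr r p = i ∧ s.iarr c p = j

end RealRAM

/-! ### Existence of the reverse Cholesky factor and inheritance of the band. -/

namespace Vecchia

open Matrix

/-! Everything reduces to one number: a bandwidth `w` of `W`, of order `n ^ (1 - 1/d) * m ^ (1/d)`.

Geometry. Cut the grid into layers orthogonal to the ordering coordinate, `N ^ (d - 1)` points each,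
where `ℓ = N ^ d`. With `r = ⌈m ^ (1/d)⌉`, a point that has enough layers behind it sees a box of `r
^ d ≥ m` predecessors within distance `d * r` spacings. Hence none of its `m` nearest predecessors
lies more than `d * r` layers back (`layer_le_of_mem_conditioning`). A nonzero `W i j` forces `i`
and `j` to be equal to, or parents of, a common `k`. Such indices differ by at most `d * r` layers,
hence by less than `(d * r + 1) * N ^ (d - 1)` positions (`matW_band`, `exists_band`).

Algebra. `W` is positive definite, because the columns of `U_Y` belonging to the observations form
`-τ⁻¹` times the identity (`posDef_matW`), so the factor `V` exists. Comparing entries of `V Vᵀ = W`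
gives a recursion from the last column down, in which no fill-in leaves the band
(`entry_eq_zero_of_band`). Each column therefore has at most `w` nonzero elements, and `V` at most
`ℓ * w`.

Computation. The program reads the bandwidth off its input, stores the band in an array of `ℓ * w`
cells, overwrites it in place by the recursion and lists the nonzero cells. Each of the `ℓ * w`
cells costs a sum of at most `w` products, so the time is of order `ℓ * w ^ 2` (`run_rcholProg`).
Correctness, memory and time are proved together with the predicate `Run`. -/

theorem exists_isCholeskyFactor {ℓ : ℕ} {A : Matrix (Fin ℓ) (Fin ℓ) ℝ} (hA : A.PosDef) :
    ∃ L, IsCholeskyFactor A L := by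
  have htri : ∀ i j, i < j → LDL.lower hA i j = 0 := by
    have h : BlockTriangular (LDL.lowerInv hA) OrderDual.toDual := fun i j hij =>
      LDL.lowerInv_triangular hA hij
    have := blockTriangular_inv_of_blockTriangular h
    exact fun i j hij => this hij
  have hpos : ∀ i, 0 < LDL.diagEntries hA i := by
    have h : (LDL.diag hA).PosDef := by
      rw [LDL.diag_eq_lowerInv_conj]
      refine hA.mul_mul_conjTranspose_same ?_
      exact vecMul_injective_of_isUnit (isUnit_of_invertible _)
    simpa [LDL.diag] using h
  set L₀ : Matrix (Fin ℓ) (Fin ℓ) ℝ :=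
    LDL.lower hA * diagonal fun i => Real.sqrt (LDL.diagEntries hA i) with hL₀
  have hmul : L₀ * L₀ᵀ = A := by
    conv_rhs => rw [← LDL.lower_conj_diag hA]
    rw [hL₀, transpose_mul, diagonal_transpose, Matrix.mul_assoc,
      ← Matrix.mul_assoc (diagonal _) (diagonal _), diagonal_mul_diagonal, ← Matrix.mul_assoc,
      conjTranspose_eq_transpose_of_trivial]
    simp only [Real.mul_self_sqrt (hpos _).le]
    rfl
  have htri₀ : ∀ i j, i < j → L₀ i j = 0 := fun i j hij => by
    simp [hL₀, mul_diagonal, htri i j hij]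
  have hdiag : ∀ i, L₀ i i ≠ 0 := by
    have hdet : L₀.det ≠ 0 := fun h => by
      have := hA.det_pos
      rw [← hmul, det_mul, h, zero_mul] at this
      exact this.false
    rw [det_of_isLowerTriangular L₀ fun i j hij => htri₀ i j hij] at hdet
    exact fun i => (Finset.prod_ne_zero_iff.1 hdet) i (Finset.mem_univ i)
  -- Flipping the signs of columns makes the diagonal positive and leaves `L₀ * L₀ᵀ` unchanged. The
  -- signs square to one because the determinant, hence each diagonal entry, is nonzero.
  refine ⟨L₀ * diagonal fun i => ((SignType.sign (L₀ i i) : SignType) : ℝ), fun i j hij => ?_, fun i => ?_, ?_⟩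
  · simp [mul_diagonal, htri₀ i j hij]
  · rw [mul_diagonal, mul_comm, sign_mul_self]
    exact abs_pos.2 (hdiag i)
  · rw [transpose_mul, diagonal_transpose, Matrix.mul_assoc,
      ← Matrix.mul_assoc (diagonal _) (diagonal _), diagonal_mul_diagonal]
    have : (fun i => ((SignType.sign (L₀ i i) : SignType) : ℝ) * (SignType.sign (L₀ i i) : SignType)) = fun _ => 1 := by
      funext i
      rcases lt_or_gt_of_ne (hdiag i) with h | h <;> simp [sign_neg, sign_pos, h]
    rw [this, diagonal_one, Matrix.one_mul, hmul]

/-- `V` is an upper-triangular factor of `W`, with positive diagonal: `V Vᵀ = W`. -/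
structure IsRevCholeskyFactor {ℓ : ℕ} (W V : Matrix (Fin ℓ) (Fin ℓ) ℝ) : Prop where
  upper : ∀ i j, j < i → V i j = 0
  diag_pos : ∀ i, 0 < V i i
  mul_transpose : V * V.transpose = W

theorem isRevCholeskyFactor_rchol {ℓ : ℕ} {A : Matrix (Fin ℓ) (Fin ℓ) ℝ} (hA : A.PosDef) :
    IsRevCholeskyFactor A (rchol A) := by
  have hrev : (rev A).PosDef := hA.submatrix Fin.rev_injective
  have h := exists_isCholeskyFactor hrev
  obtain ⟨h1, h2, h3⟩ : IsCholeskyFactor (rev A) (chol (rev A)) := by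
    rw [chol, dif_pos h]
    exact h.choose_spec
  refine ⟨fun i j hij => h1 _ _ (Fin.rev_lt_rev.2 hij), fun i => h2 _, ?_⟩
  have : rchol A * (rchol A)ᵀ = rev (chol (rev A) * (chol (rev A))ᵀ) := by
    ext i j
    simp only [rchol, rev, mul_apply, transpose_apply, submatrix_apply]
    exact Equiv.sum_comp Fin.revPerm
      fun k => chol (A.submatrix Fin.rev Fin.rev) i.rev k * chol (A.submatrix Fin.rev Fin.rev) j.rev k
  rw [this, h3]
  ext i j
  simp [rev]

/-- The entries of a matrix, extended by zero to all pairs of natural numbers. -/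
noncomputable def entry {ℓ : ℕ} (A : Matrix (Fin ℓ) (Fin ℓ) ℝ) (i j : ℕ) : ℝ :=
  if h : i < ℓ ∧ j < ℓ then A ⟨i, h.1⟩ ⟨j, h.2⟩ else 0

@[simp] theorem entry_fin {ℓ : ℕ} (A : Matrix (Fin ℓ) (Fin ℓ) ℝ) (i j : Fin ℓ) :
    entry A i j = A i j := by
  simp [entry]

namespace IsRevCholeskyFactor

variable {ℓ : ℕ} {W V : Matrix (Fin ℓ) (Fin ℓ) ℝ}

theorem symm (h : IsRevCholeskyFactor W V) (i j : Fin ℓ) : W i j = W j i := by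
  rw [← h.mul_transpose]
  simp only [mul_apply, transpose_apply, mul_comm]

theorem entry_eq_sum (h : IsRevCholeskyFactor W V) {i j : ℕ} (hi : i < ℓ) (hj : j < ℓ) :
    entry W i j = ∑ k ∈ Finset.Ico i ℓ, entry V i k * entry V j k := by
  have h0 : entry W i j = ∑ k ∈ Finset.range ℓ, entry V i k * entry V j k := by
    rw [Finset.sum_range]
    simp only [entry, hi, hj, and_self, dite_true, ← h.mul_transpose, mul_apply,
      transpose_apply, Fin.is_lt, Fin.eta]
  rw [h0, Finset.range_eq_Ico]
  refine (Finset.sum_subset (Finset.Ico_subset_Ico_left (Nat.zero_le i)) fun k hk hk' => ?_).symm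
  simp only [Finset.mem_Ico, not_and, not_lt] at hk hk'
  have hki : k < i := by omega
  rw [show entry V i k = 0 by simpa [entry, hi, hk.2] using h.upper ⟨i, hi⟩ ⟨k, hk.2⟩ hki, zero_mul]

/-- The step of the reverse Cholesky algorithm. -/
theorem entry_mul_diag (h : IsRevCholeskyFactor W V) {i j : ℕ} (hi : i < ℓ) (hj : j < ℓ) :
    entry V j i * entry V i i =
      entry W i j - ∑ k ∈ Finset.Ico (i + 1) ℓ, entry V j k * entry V i k := by
  rw [h.entry_eq_sum hi hj, Finset.sum_eq_sum_Ico_succ_bot hi]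
  simp only [mul_comm]
  ring

theorem entry_diag_pos (h : IsRevCholeskyFactor W V) {i : ℕ} (hi : i < ℓ) : 0 < entry V i i := by
  simpa [entry, hi] using h.diag_pos ⟨i, hi⟩

/-- The factor inherits the band structure. -/
theorem entry_eq_zero_of_band (h : IsRevCholeskyFactor W V) {w : ℕ}
    (hw : ∀ i j : Fin ℓ, W i j ≠ 0 → (i : ℕ) < j + w) {i j : ℕ} (hij : j + w ≤ i) :
    entry V j i = 0 := by
  by_cases hi : i < ℓ
  -- Columns are treated from the last one down. For `j + w ≤ i`, the entry of `W` vanishes, and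
  -- each term of the sum contains `V j k` with `k > i`, even farther from the diagonal, which is
  -- zero by induction.
  · induction hn : ℓ - i using Nat.strong_induction_on generalizing i with
    | _ n ih =>
      have hj : j < ℓ := by omega
      have := h.entry_mul_diag hi hj
      rw [Finset.sum_eq_zero, sub_zero,
        show entry W i j = 0 from ?_] at this
      · exact (mul_eq_zero.1 this).resolve_right (h.entry_diag_pos hi).ne'
      · by_contra hne
        have := hw ⟨i, hi⟩ ⟨j, hj⟩ (by simpa [entry, hi, hj] using hne)
        simp only at this
        omega
      · intro k hk
        rw [Finset.mem_Ico] at hk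
        rw [ih (ℓ - k) (by omega) (by omega) hk.2 rfl, zero_mul]
  · simp [entry, hi]

/-- The truncated sum has fewer than `w` terms when `j ≤ i`, which is the source of the quadratic
dependence of the running time on the bandwidth. -/
theorem entry_mul_diag_of_band (h : IsRevCholeskyFactor W V) {w : ℕ}
    (hw : ∀ i j : Fin ℓ, W i j ≠ 0 → (i : ℕ) < j + w) {i j : ℕ} (hi : i < ℓ) (hj : j < ℓ) :
    entry V j i * entry V i i =
      entry W i j - ∑ k ∈ Finset.Ico (i + 1) (min (j + w) ℓ), entry V j k * entry V i k := by
  rw [h.entry_mul_diag hi hj]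
  congr 1
  refine (Finset.sum_subset (Finset.Ico_subset_Ico_right (min_le_right _ _)) fun k hk hk' => ?_).symm
  simp only [Finset.mem_Ico, not_and, not_lt] at hk hk'
  rw [h.entry_eq_zero_of_band hw (show j + w ≤ k by omega), zero_mul]

theorem eq_zero_of_band (h : IsRevCholeskyFactor W V) {w : ℕ}
    (hw : ∀ i j : Fin ℓ, W i j ≠ 0 → (i : ℕ) < j + w) {i j : Fin ℓ} (hij : (j : ℕ) + w ≤ i) :
    V j i = 0 := by
  simpa using h.entry_eq_zero_of_band hw hij

/-- The number of nonzero elements in a column of a banded factor. -/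
theorem ncard_col_le (h : IsRevCholeskyFactor W V) {w : ℕ}
    (hw : ∀ i j : Fin ℓ, W i j ≠ 0 → (i : ℕ) < j + w) (i : Fin ℓ) :
    Set.ncard {j | V j i ≠ 0} ≤ w := by
  have hsub : (fun j : Fin ℓ => (j : ℕ)) '' {j | V j i ≠ 0} ⊆
      (Finset.Ico (i + 1 - w : ℕ) (i + 1) : Set ℕ) := by
    rintro _ ⟨j, hj, rfl⟩
    have h1 : j ≤ i := not_lt.1 fun hlt => hj (h.upper _ _ hlt)
    have h2 : (i : ℕ) < j + w := not_le.1 fun hle => hj (h.eq_zero_of_band hw hle)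
    simp only [Finset.coe_Ico, Set.mem_Ico]
    have : (j : ℕ) ≤ i := h1
    omega
  rw [← Set.ncard_image_of_injective _ Fin.val_injective]
  refine (Set.ncard_le_ncard hsub (Finset.finite_toSet _)).trans ?_
  rw [Set.ncard_coe_finset, Nat.card_Ico]
  omega

/-- The number of nonzero elements of a banded factor. -/
theorem ncard_le (h : IsRevCholeskyFactor W V) {w : ℕ}
    (hw : ∀ i j : Fin ℓ, W i j ≠ 0 → (i : ℕ) < j + w) :
    Set.ncard {p : Fin ℓ × Fin ℓ | V p.1 p.2 ≠ 0} ≤ ℓ * w := by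
  classical
  have hcol := h.ncard_col_le hw
  simp only [Set.ncard_eq_toFinset_card'] at hcol ⊢
  rw [Finset.card_eq_sum_card_fiberwise (f := Prod.snd) (t := Finset.univ) (by simp)]
  refine (Finset.sum_le_card_nsmul _ _ w fun i _ => ?_).trans (by simp)
  refine le_trans ?_ (hcol i)
  refine Finset.card_le_card_of_injOn Prod.fst ?_ ?_
  · rintro ⟨a, b⟩ hab
    simp only [Finset.coe_filter, Set.mem_toFinset, Set.mem_ofPred_eq] at hab
    simpa [← hab.2] using hab.1
  · rintro ⟨a, b⟩ hab ⟨a', b'⟩ hab' haa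
    simp only [Finset.coe_filter, Set.mem_toFinset, Set.mem_ofPred_eq] at hab hab' haa
    rw [haa, hab.2, hab'.2]

end IsRevCholeskyFactor

end Vecchia

/-! ### Nearest neighbors on the grid and the band of the precision matrix. -/

namespace Vecchia

open Matrix

section Geometry

variable {d ℓ : ℕ} {S : Fin ℓ → EuclideanSpace ℝ (Fin d)}

/-- The window starts at `x`, or is shifted down so as to end at `N - 1`; either way it stays within
`r` of `x`. -/
theorem exists_window {N r : ℕ} (hr : r ≤ N) (x : Fin N) :
    ∃ s : Finset (Fin N), s.card = r ∧ ∀ y ∈ s, (y : ℕ) ≤ x + r ∧ (x : ℕ) ≤ y + r := by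
  have hx := x.2
  refine ⟨Finset.univ.image fun u : Fin r => ⟨min (x : ℕ) (N - r) + u, by omega⟩, ?_, ?_⟩
  · rw [Finset.card_image_of_injective, Finset.card_univ, Fintype.card_fin]
    intro u v huv
    simp only [Fin.mk.injEq, add_right_inj] at huv
    exact Fin.ext huv
  · intro y hy
    obtain ⟨u, -, rfl⟩ := Finset.mem_image.1 hy
    have := u.2
    simp only
    omega

/-- Used in the ordering coordinate: a strictly lower layer guarantees an earlier index, however
ties are broken. -/
theorem exists_window_below {N r : ℕ} (x : Fin N) (hr : r ≤ x) :
    ∃ s : Finset (Fin N), s.card = r ∧ ∀ y ∈ s, (y : ℕ) < x ∧ (x : ℕ) ≤ y + r := by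
  have hx := x.2
  refine ⟨Finset.univ.image fun u : Fin r => ⟨x - r + u, by omega⟩, ?_, ?_⟩
  · rw [Finset.card_image_of_injective, Finset.card_univ, Fintype.card_fin]
    intro u v huv
    simp only [Fin.mk.injEq, add_right_inj] at huv
    exact Fin.ext huv
  · intro y hy
    obtain ⟨u, -, rfl⟩ := Finset.mem_image.1 hy
    have := u.2
    simp only
    omega

/-- A location conditions on locations in nearby layers only, the layers being orthogonal to the
coordinate of the order. -/
theorem layer_le_of_mem_conditioning {N m r : ℕ} {a : EuclideanSpace ℝ (Fin d)} {h : ℝ}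
    {e : Fin ℓ ≃ (Fin d → Fin N)} {c : Fin d} {q : Fin ℓ → Finset (Fin ℓ)} (hpos : 0 < h)
    (hS : ∀ i k, S i k = a k + h * ((e i k : ℕ) : ℝ)) (hc : ∀ i j, i < j → S i c ≤ S j c)
    (hq : IsNearestNeighborConditioning S m q) (hrN : r ≤ N) (hmr : m ≤ r ^ d)
    {j k : Fin ℓ} (hj : j ∈ q k) : (e k c : ℕ) ≤ e j c + d * r := by
  classical
  by_contra! hlt
  obtain ⟨hq1, hq2, hq3⟩ := hq k
  have hd : 1 ≤ d := Nat.one_le_iff_ne_zero.2 fun h0 => by subst h0; exact c.elim0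
  have hrd : r ≤ d * r := Nat.le_mul_of_pos_left r hd
  have hwin : ∀ c' : Fin d, ∃ s : Finset (Fin N), s.card = r ∧ ∀ y ∈ s,
      (y : ℕ) ≤ e k c' + r ∧ (e k c' : ℕ) ≤ y + r ∧ (c' = c → (y : ℕ) < e k c') := by
    intro c'
    by_cases hcc : c' = c
    · subst hcc
      obtain ⟨s, hs, hs'⟩ := exists_window_below (r := r) (e k c') (by omega)
      exact ⟨s, hs, fun y hy => ⟨by have := (hs' y hy).1; omega, (hs' y hy).2,
        fun _ => (hs' y hy).1⟩⟩
    · obtain ⟨s, hs, hs'⟩ := exists_window hrN (e k c')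
      exact ⟨s, hs, fun y hy => ⟨(hs' y hy).1, (hs' y hy).2, fun h => absurd h hcc⟩⟩
  choose s hs hs' using hwin
  -- `T` is a box of `r ^ d` predecessors of `k`, all closer to `k` than `j`. The nearest-neighbor
  -- rule then puts all of `T` into `q k` besides `j`, which makes `q k` larger than `m`.
  set T : Finset (Fin ℓ) := (Fintype.piFinset s).map e.symm.toEmbedding with hT
  have hTcard : T.card = r ^ d := by
    rw [hT, Finset.card_map, Fintype.card_piFinset]
    simp [hs]
  have hTmem : ∀ t ∈ T, ∀ c', e t c' ∈ s c' := by
    intro t ht c'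
    rw [hT, Finset.mem_map] at ht
    obtain ⟨f, hf, rfl⟩ := ht
    simpa using Fintype.mem_piFinset.1 hf c'
  have hTlt : ∀ t ∈ T, t < k := by
    intro t ht
    by_contra! hkt
    have hlt' := (hs' c _ (hTmem t ht c)).2.2 rfl
    rcases hkt.eq_or_lt with rfl | hkt
    · exact hlt'.false
    · have := hc _ _ hkt
      rw [hS, hS, add_le_add_iff_left, mul_le_mul_iff_right₀ hpos, Nat.cast_le] at this
      omega
  have hdiff : ∀ i i' c', S i c' - S i' c' = h * (((e i c' : ℕ) : ℝ) - (e i' c' : ℕ)) := by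
    intro i i' c'
    rw [hS, hS]
    ring
  have hdistT : ∀ t ∈ T, dist (S k) (S t) ≤ h * (d * r : ℕ) := by
    intro t ht
    rw [EuclideanSpace.dist_eq]
    refine Real.sqrt_le_iff.2 ⟨by positivity, ?_⟩
    have hle : ∀ c', dist (S k c') (S t c') ^ 2 ≤ (h * r) ^ 2 := by
      intro c'
      rw [Real.dist_eq, sq_abs, hdiff]
      obtain ⟨h1, h2, -⟩ := hs' c' _ (hTmem t ht c')
      refine sq_le_sq' ?_ ?_
      · rw [← mul_neg]
        refine mul_le_mul_of_nonneg_left ?_ hpos.le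
        have : ((e t c' : ℕ) : ℝ) ≤ (e k c' : ℕ) + r := by exact_mod_cast h1
        linarith
      · refine mul_le_mul_of_nonneg_left ?_ hpos.le
        have : ((e k c' : ℕ) : ℝ) ≤ (e t c' : ℕ) + r := by exact_mod_cast h2
        linarith
    refine (Finset.sum_le_sum fun c' _ => hle c').trans ?_
    -- The diameter estimate is `h * r * √d`; replacing `√d` by `d` keeps the number of layers an
    -- integer.
    have hd' : (1 : ℝ) ≤ d := by exact_mod_cast hd
    simp only [Finset.sum_const, Finset.card_univ, Fintype.card_fin, nsmul_eq_mul, Nat.cast_mul]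
    have : (h * (d * r)) ^ 2 = d * (d * (h * r) ^ 2) := by ring
    rw [this]
    refine mul_le_mul_of_nonneg_left (le_mul_of_one_le_left (sq_nonneg _) hd') (by positivity)
  have hdistj : h * (d * r : ℕ) < dist (S k) (S j) := by
    refine lt_of_lt_of_le ?_ ((Real.le_norm_self _).trans
      ((PiLp.norm_apply_le (S k - S j) c).trans_eq (dist_eq_norm _ _).symm))
    rw [PiLp.sub_apply, hdiff]
    refine mul_lt_mul_of_pos_left ?_ hpos
    have : ((e j c : ℕ) : ℝ) + (d * r : ℕ) < (e k c : ℕ) := by exact_mod_cast hlt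
    linarith
  have hTq : T ⊆ (q k).erase j := by
    intro t ht
    refine Finset.mem_erase.2 ⟨?_, ?_⟩
    · rintro rfl
      exact (hdistj.trans_le (hdistT _ ht)).false
    · by_contra htq
      exact (hdistj.trans_le ((hq3 j hj t (hTlt t ht) htq).trans (hdistT t ht))).false
  have h1 := Finset.card_le_card hTq
  have h2 := Finset.card_erase_lt_of_mem hj
  rw [hTcard] at h1
  have h3 : min m (k : ℕ) ≤ m := min_le_left _ _
  omega

/-- Between two locations in nearby layers there are few locations. -/
theorem index_lt_of_layer_le {N r : ℕ} {a : EuclideanSpace ℝ (Fin d)} {h : ℝ}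
    {e : Fin ℓ ≃ (Fin d → Fin N)} {c : Fin d} (hpos : 0 < h)
    (hS : ∀ i k, S i k = a k + h * ((e i k : ℕ) : ℝ)) (hc : ∀ i j, i < j → S i c ≤ S j c)
    {i j : Fin ℓ} (hji : j ≤ i) (hlay : (e i c : ℕ) ≤ e j c + r) :
    (i : ℕ) < j + (r + 1) * N ^ (d - 1) := by
  classical
  have hmono : ∀ i j, i ≤ j → (e i c : ℕ) ≤ e j c := by
    intro i j hij
    rcases hij.eq_or_lt with rfl | hij
    · rfl
    · have := hc _ _ hij
      rwa [hS, hS, add_le_add_iff_left, mul_le_mul_iff_right₀ hpos, Nat.cast_le] at this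
  -- The layer number is monotone in the index, so all points indexed from `j` to `i` lie in a slab
  -- of at most `r + 1` layers. Counting the slab bounds `i - j + 1`.
  set s : Fin d → Finset (Fin N) :=
    fun c' => if c' = c then Finset.Icc (e j c) (e i c) else Finset.univ with hs
  have hsub : (Finset.Icc j i).map e.toEmbedding ⊆ Fintype.piFinset s := by
    intro f hf
    obtain ⟨t, ht, rfl⟩ := Finset.mem_map.1 hf
    rw [Finset.mem_Icc] at ht
    rw [Fintype.mem_piFinset]
    intro c'
    simp only [hs]
    split_ifs with hcc
    · subst hcc
      exact Finset.mem_Icc.2 ⟨hmono _ _ ht.1, hmono _ _ ht.2⟩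
    · exact Finset.mem_univ _
  have hcard := Finset.card_le_card hsub
  rw [Finset.card_map, Fin.card_Icc, Fintype.card_piFinset,
    ← Finset.mul_prod_erase _ _ (Finset.mem_univ c)] at hcard
  have h1 : (s c).card ≤ r + 1 := by
    simp only [hs, if_true, Fin.card_Icc]
    omega
  have h2 : ∏ c' ∈ Finset.univ.erase c, (s c').card = N ^ (d - 1) := by
    rw [Finset.prod_congr rfl fun c' hc' => ?_, Finset.prod_const,
      Finset.card_erase_of_mem (Finset.mem_univ c), Finset.card_univ, Fintype.card_fin]
    simp [hs, Finset.ne_of_mem_erase hc']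
  rw [h2] at hcard
  have := hcard.trans (Nat.mul_le_mul_right _ h1)
  have hji' : (j : ℕ) ≤ i := hji
  omega

end Geometry

section Precision

variable {d ℓ : ℕ} {K : EuclideanSpace ℝ (Fin d) → EuclideanSpace ℝ (Fin d) → ℝ} {τ : ℝ}
  {S : Fin ℓ → EuclideanSpace ℝ (Fin d)} {q : Fin ℓ → Finset (Fin ℓ)}

theorem matUY_inr_eq_zero {i j : Fin ℓ} (h : i ≠ j) : matUY K τ S q i (.inr j) = 0 := by
  simp [matUY, matU, parents, h]

theorem matUY_inl_eq_zero {i j : Fin ℓ} (h : i ≠ j) (hq : i ∉ q j) :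
    matUY K τ S q i (.inl j) = 0 := by
  simp [matUY, matU, parents, h, hq]

/-- The only parent of `z i` is `y i`, so a one-by-one matrix is inverted and its entry equals the
covariance of `z i` and `y i`. -/
theorem coefB_inr {i : Fin ℓ} (hK : K (S i) (S i) ≠ 0)
    (w : {w // w ∈ parents q (Sum.inr i)}) : coefB K τ S q (.inr i) w = 1 := by
  have hu : ∀ v : {w // w ∈ parents q (Sum.inr i)}, (v : Fin ℓ ⊕ Fin ℓ) = Sum.inl i := fun v => by
    simpa [parents] using v.2
  have : Subsingleton {w // w ∈ parents q (Sum.inr i)} :=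
    ⟨fun u v => Subtype.ext ((hu u).trans (hu v).symm)⟩
  rw [coefB, Fintype.sum_subsingleton _ w, inv_subsingleton, diagonal_apply_eq, submatrix_apply, hu]
  simp [covX, hK]

theorem condVar_inr {i : Fin ℓ} (hK : K (S i) (S i) ≠ 0) :
    condVar K τ S q (.inr i) = τ ^ 2 := by
  have hu : ∀ v : {w // w ∈ parents q (Sum.inr i)}, (v : Fin ℓ ⊕ Fin ℓ) = Sum.inl i := fun v => by
    simpa [parents] using v.2
  have : Subsingleton {w // w ∈ parents q (Sum.inr i)} :=
    ⟨fun u v => Subtype.ext ((hu u).trans (hu v).symm)⟩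
  rw [condVar, Fintype.sum_subsingleton _ ⟨Sum.inl i, by simp [parents]⟩, coefB_inr hK]
  simp [covX]

theorem matUY_inr_self {i : Fin ℓ} (hK : K (S i) (S i) ≠ 0) (hτ : 0 < τ) :
    matUY K τ S q i (.inr i) = -τ⁻¹ := by
  have hmem : Sum.inl i ∈ parents q (Sum.inr i) := by simp [parents]
  simp only [matUY, submatrix_apply, id, matU, reduceCtorEq, if_false, hmem, dite_true,
    coefB_inr hK, condVar_inr hK, Real.sqrt_sq hτ.le]
  ring

theorem IsPosDefKernel.diag_pos {D : Set (EuclideanSpace ℝ (Fin d))} (hK : IsPosDefKernel D K)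
    {x : EuclideanSpace ℝ (Fin d)} (hx : x ∈ D) : 0 < K x x := by
  simpa using (hK 1 (fun _ => x) (Function.injective_of_subsingleton _) fun _ => hx).diag_pos
    (i := 0)

/-- The observation columns of `U_Y` form `-τ⁻¹` times the identity. A row vector annihilated by
`U_Y` is thus zero, whatever the latent columns are. -/
theorem posDef_matW {D : Set (EuclideanSpace ℝ (Fin d))} (hK : IsPosDefKernel D K) (hτ : 0 < τ)
    (hS : ∀ i, S i ∈ D) : (matW K τ S q).PosDef := by
  have hinj : Function.Injective (matUY K τ S q).vecMul := by
    intro x y hxy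
    funext i
    have h := congrFun hxy (Sum.inr i)
    simp only [vecMul, dotProduct] at h
    rw [Finset.sum_eq_single i, Finset.sum_eq_single i,
      matUY_inr_self (hK.diag_pos (hS i)).ne' hτ] at h
    · exact mul_right_cancel₀ (neg_ne_zero.2 (inv_ne_zero hτ.ne')) h
    all_goals first | (intro k _ hk; rw [matUY_inr_eq_zero hk, mul_zero]) | simp
  simpa [matW, conjTranspose_eq_transpose_of_trivial] using PosDef.mul_conjTranspose_self _ hinj

/-- Two variables that interact are equal or have a common child in the conditioning graph, or one
is a parent of the other. -/
theorem exists_of_matW_ne_zero {i j : Fin ℓ} (h : matW K τ S q i j ≠ 0) :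
    ∃ k, (i = k ∨ i ∈ q k) ∧ (j = k ∨ j ∈ q k) := by
  by_contra! hne
  refine h ?_
  rw [matW, mul_apply, Fintype.sum_sum_type]
  simp only [transpose_apply]
  have key : ∀ k, ¬((i = k ∨ i ∈ q k) ∧ (j = k ∨ j ∈ q k)) := fun k hk => by
    have := hne k hk.1
    tauto
  have h1 : ∀ k, matUY K τ S q i (.inl k) * matUY K τ S q j (.inl k) = 0 := by
    intro k
    rcases not_and_or.1 (key k) with hk | hk <;> rw [not_or] at hk <;>
      simp [matUY_inl_eq_zero hk.1 hk.2]
  have h2 : ∀ k, matUY K τ S q i (.inr k) * matUY K τ S q j (.inr k) = 0 := by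
    intro k
    rcases not_and_or.1 (key k) with hk | hk <;> rw [not_or] at hk <;>
      simp [matUY_inr_eq_zero hk.1]
  simp [h1, h2]

/-- The precision matrix `W` is banded. -/
theorem matW_band {N m r : ℕ} {a : EuclideanSpace ℝ (Fin d)} {h : ℝ}
    {e : Fin ℓ ≃ (Fin d → Fin N)} {c : Fin d} (hpos : 0 < h)
    (hS : ∀ i k, S i k = a k + h * ((e i k : ℕ) : ℝ)) (hc : ∀ i j, i < j → S i c ≤ S j c)
    (hq : IsNearestNeighborConditioning S m q) (hrN : r ≤ N) (hmr : m ≤ r ^ d)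
    {i j : Fin ℓ} (hij : matW K τ S q i j ≠ 0) :
    (i : ℕ) < j + (d * r + 1) * N ^ (d - 1) := by
  rcases le_or_gt i j with hle | hlt
  · have hN : 0 < N := (e i c).pos
    have : (i : ℕ) ≤ j := hle
    have : 0 < (d * r + 1) * N ^ (d - 1) := by positivity
    omega
  · obtain ⟨k, hik, hjk⟩ := exists_of_matW_ne_zero hij
    have hik' : i ≤ k := by
      rcases hik with rfl | hik
      · rfl
      · exact ((hq k).1 i hik).le
    have hjk' : j ∈ q k := hjk.resolve_left (hlt.trans_le hik').ne
    -- The layer of `i` is at most that of the common child `k`, which is at most `d * r` above the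
    -- layer of `j`.
    refine index_lt_of_layer_le hpos hS hc hlt.le (le_trans ?_
      (layer_le_of_mem_conditioning hpos hS hc hq hrN hmr hjk'))
    rcases hik'.eq_or_lt with rfl | hik'
    · rfl
    · have := hc _ _ hik'
      rwa [hS, hS, add_le_add_iff_left, mul_le_mul_iff_right₀ hpos, Nat.cast_le] at this

end Precision

end Vecchia

/-! ### Rules for proving correctness, memory and time of programs. -/

namespace RealRAM

namespace State

@[simp] theorem setI_ivar (s : State) (x n y : ℕ) :
    (s.setI x n).ivar y = if y = x then n else s.ivar y := by
  simp [setI, Function.update_apply]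
@[simp] theorem setI_rvar (s : State) (x n : ℕ) : (s.setI x n).rvar = s.rvar := rfl
@[simp] theorem setI_iarr (s : State) (x n : ℕ) : (s.setI x n).iarr = s.iarr := rfl
@[simp] theorem setI_rarr (s : State) (x n : ℕ) : (s.setI x n).rarr = s.rarr := rfl

@[simp] theorem setR_rvar (s : State) (x y : ℕ) (u : ℝ) :
    (s.setR x u).rvar y = if y = x then u else s.rvar y := by
  simp [setR, Function.update_apply]
@[simp] theorem setR_ivar (s : State) (x : ℕ) (u : ℝ) : (s.setR x u).ivar = s.ivar := rfl
@[simp] theorem setR_rarr (s : State) (x : ℕ) (u : ℝ) : (s.setR x u).rarr = s.rarr := rfl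

@[simp] theorem writeI_iarr (s : State) (a k n b : ℕ) :
    (s.writeI a k n).iarr b = if b = a then Function.update (s.iarr a) k n else s.iarr b := by
  simp [writeI, Function.update_apply]
@[simp] theorem writeI_ivar (s : State) (a k n : ℕ) : (s.writeI a k n).ivar = s.ivar := rfl
@[simp] theorem writeI_rarr (s : State) (a k n : ℕ) : (s.writeI a k n).rarr = s.rarr := rfl

@[simp] theorem writeR_rarr (s : State) (a k b : ℕ) (u : ℝ) :
    (s.writeR a k u).rarr b = if b = a then Function.update (s.rarr a) k u else s.rarr b := by
  simp [writeR, Function.update_apply]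
@[simp] theorem writeR_ivar (s : State) (a k : ℕ) (u : ℝ) : (s.writeR a k u).ivar = s.ivar := rfl
@[simp] theorem writeR_iarr (s : State) (a k : ℕ) (u : ℝ) : (s.writeR a k u).iarr = s.iarr := rfl

end State

/-- With memory bound `M`, the program `p`, started in `s`, halts after time at most `T` in a
state with the property `Q`. -/
def Run (M : ℕ) (p : Prog) (s : State) (T : ℕ) (Q : State → Prop) : Prop :=
  ∃ s' t, Exec M p s s' t ∧ t ≤ T ∧ Q s'

namespace Run

variable {M T T₁ T₂ : ℕ} {s : State} {p q : Prog} {b : Test} {Q Q' : State → Prop}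

theorem mono (h : Run M p s T₁ Q) (hT : T₁ ≤ T) (hQ : ∀ s', Q s' → Q' s') : Run M p s T Q' := by
  obtain ⟨s', t, he, ht, hs⟩ := h
  exact ⟨s', t, he, ht.trans hT, hQ _ hs⟩

theorem skip (h : Q s) : Run M .skip s T Q := ⟨s, 0, .skip s, Nat.zero_le _, h⟩

theorem iset {x : ℕ} {e : IExpr} (he : e.Ok M s) (hT : e.cost + 1 ≤ T)
    (h : Q (s.setI x (e.eval s))) : Run M (.iset x e) s T Q :=
  ⟨_, _, .iset s x e he, hT, h⟩

theorem rset {x : ℕ} {e : RExpr} (he : e.Ok M s) (hT : e.cost + 1 ≤ T)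
    (h : Q (s.setR x (e.eval s))) : Run M (.rset x e) s T Q :=
  ⟨_, _, .rset s x e he, hT, h⟩

theorem iwrite {a : ℕ} {e f : IExpr} (he : e.Ok M s) (hf : f.Ok M s)
    (hT : e.cost + f.cost + 1 ≤ T) (h : Q (s.writeI a (e.eval s) (f.eval s))) :
    Run M (.iwrite a e f) s T Q :=
  ⟨_, _, .iwrite s a e f he hf, hT, h⟩

theorem rwrite {a : ℕ} {e : IExpr} {f : RExpr} (he : e.Ok M s) (hf : f.Ok M s)
    (hT : e.cost + f.cost + 1 ≤ T) (h : Q (s.writeR a (e.eval s) (f.eval s))) :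
    Run M (.rwrite a e f) s T Q :=
  ⟨_, _, .rwrite s a e f he hf, hT, h⟩

theorem seq (h : Run M p s T₁ fun s' => Run M q s' T₂ Q) :
    Run M (.seq p q) s (T₁ + T₂) Q := by
  obtain ⟨s', t, he, ht, s'', t', he', ht', hs⟩ := h
  exact ⟨s'', t + t', .seq _ _ _ _ _ _ _ he he', Nat.add_le_add ht ht', hs⟩

/-- This and the next three rules deduct the cost of a leading assignment from a fixed time budget,
so that the budget of a block need not be split in advance. -/
theorem iset_seq {x : ℕ} {e : IExpr} (he : e.Ok M s) (hT : e.cost + 1 ≤ T)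
    (h : Run M q (s.setI x (e.eval s)) (T - (e.cost + 1)) Q) :
    Run M (.seq (.iset x e) q) s T Q :=
  (seq (iset he le_rfl h)).mono (Nat.add_sub_of_le hT).le fun _ => id

theorem rset_seq {x : ℕ} {e : RExpr} (he : e.Ok M s) (hT : e.cost + 1 ≤ T)
    (h : Run M q (s.setR x (e.eval s)) (T - (e.cost + 1)) Q) :
    Run M (.seq (.rset x e) q) s T Q :=
  (seq (rset he le_rfl h)).mono (Nat.add_sub_of_le hT).le fun _ => id

theorem iwrite_seq {a : ℕ} {e f : IExpr} (he : e.Ok M s) (hf : f.Ok M s)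
    (hT : e.cost + f.cost + 1 ≤ T)
    (h : Run M q (s.writeI a (e.eval s) (f.eval s)) (T - (e.cost + f.cost + 1)) Q) :
    Run M (.seq (.iwrite a e f) q) s T Q :=
  (seq (iwrite he hf le_rfl h)).mono (Nat.add_sub_of_le hT).le fun _ => id

theorem rwrite_seq {a : ℕ} {e : IExpr} {f : RExpr} (he : e.Ok M s) (hf : f.Ok M s)
    (hT : e.cost + f.cost + 1 ≤ T)
    (h : Run M q (s.writeR a (e.eval s) (f.eval s)) (T - (e.cost + f.cost + 1)) Q) :
    Run M (.seq (.rwrite a e f) q) s T Q :=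
  (seq (rwrite he hf le_rfl h)).mono (Nat.add_sub_of_le hT).le fun _ => id

theorem ite (hb : b.Ok M s) (hT : b.cost ≤ T) (hp : b.Holds s → Run M p s (T - b.cost) Q)
    (hq : ¬ b.Holds s → Run M q s (T - b.cost) Q) : Run M (.ite b p q) s T Q := by
  by_cases h : b.Holds s
  · obtain ⟨s', t, he, ht, hs⟩ := hp h
    exact ⟨s', _, .ite_true b p q s s' t hb h he, by omega, hs⟩
  · obtain ⟨s', t, he, ht, hs⟩ := hq h
    exact ⟨s', _, .ite_false b p q s s' t hb h he, by omega, hs⟩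

/-- The rule for counting loops. -/
theorem loop (Inv : ℕ → State → Prop) (m n : ℕ) (hmn : m ≤ n)
    (htest : ∀ k s, k ≤ n → Inv k s → b.Ok M s ∧ (b.Holds s ↔ k < n))
    (hbody : ∀ k s, m ≤ k → k < n → Inv k s → Run M p s T (Inv (k + 1))) (h : Inv m s) :
    Run M (.loop b p) s ((n - m) * (T + b.cost) + b.cost) (Inv n) := by
  induction hk : n - m generalizing s m with
  | zero =>
    obtain rfl : m = n := by omega
    obtain ⟨h1, h2⟩ := htest _ s le_rfl h
    exact ⟨s, _, .loop_false b p s h1 fun h3 => (h2.1 h3).false, by simp, h⟩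
  | succ k ih =>
    have hlt : m < n := by omega
    obtain ⟨h1, h2⟩ := htest m s hmn h
    obtain ⟨s', t, he, ht, hs⟩ := hbody m s le_rfl hlt h
    obtain ⟨s'', t', he', ht', hs'⟩ :=
      ih (m + 1) hlt (fun k s hk => hbody k s (by omega)) hs (by omega)
    refine ⟨s'', _, .loop_true b p s s' s'' t t' h1 (h2.2 hlt) he he', ?_, hs'⟩
    rw [Nat.succ_mul]
    omega

end Run

end RealRAM

/-! ### Reading off the bandwidth and filling the band array. -/

namespace RealRAM

/-- Layout of the band array: column `i` occupies `w` consecutive cells, and the element at distance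
`a` above the diagonal has address `i * w + a`. -/
theorem band_addr_lt {ℓ w i a : ℕ} (hi : i < ℓ) (ha : a < w) : i * w + a < ℓ * w := by
  calc i * w + a < (i + 1) * w := by rw [Nat.succ_mul]; omega
    _ ≤ ℓ * w := Nat.mul_le_mul_right _ hi

theorem band_addr_inj {w i a i' a' : ℕ} (ha : a < w) (ha' : a' < w)
    (h : i * w + a = i' * w + a') : i = i' ∧ a = a' := by
  have hi : i = i' := by
    rcases lt_trichotomy i i' with hlt | heq | hlt
    · have := band_addr_lt hlt ha
      omega
    · exact heq
    · have := band_addr_lt hlt ha'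
      omega
  subst hi
  exact ⟨rfl, by omega⟩

/-- Computes the bandwidth of the input in the index variable `3`. -/
def bandwidthProg : Prog :=
  .seq (.iset 3 (.const 1)) <| .seq (.iset 4 (.const 0)) <| .loop (.ilt (.var 4) (.var 1)) <|
    .seq (.ite (.ilt (.var 3) (.sub (.add (.read 0 (.var 4)) (.const 1)) (.read 1 (.var 4))))
      (.iset 3 (.sub (.add (.read 0 (.var 4)) (.const 1)) (.read 1 (.var 4)))) .skip)
      (.iset 4 (.add (.var 4) (.const 1)))

/-- Fills the band array `2` with zeros. -/
def zeroProg : Prog :=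
  .seq (.iset 4 (.const 0)) <| .loop (.ilt (.var 4) (.mul (.var 0) (.var 3))) <|
    .seq (.rwrite 2 (.var 4) (.const 0)) (.iset 4 (.add (.var 4) (.const 1)))

/-- Copies the upper triangle of the input into the band array. -/
def scatterProg : Prog :=
  .seq (.iset 4 (.const 0)) <| .loop (.ilt (.var 4) (.var 1)) <|
    .seq (.ite (.ilt (.read 0 (.var 4)) (.read 1 (.var 4))) .skip
      (.rwrite 2 (.add (.mul (.read 0 (.var 4)) (.var 3))
        (.sub (.read 0 (.var 4)) (.read 1 (.var 4)))) (.read 0 (.var 4))))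
      (.iset 4 (.add (.var 4) (.const 1)))

variable {M n ℓ w : ℕ} {R C : ℕ → ℕ} {v : ℕ → ℝ} {s : State}

/-- The state holds the input: the list of length `n` with row numbers `R`, column numbers `C`
and values `v`. -/
structure HasInput (ℓ n : ℕ) (R C : ℕ → ℕ) (v : ℕ → ℝ) (s : State) : Prop where
  size : s.ivar 0 = ℓ
  num : s.ivar 1 = n
  row : s.iarr 0 = R
  col : s.iarr 1 = C
  val : s.rarr 0 = v

/-- The program is given neither `d` nor `m`, so the bandwidth must come from the data. The detected
value never exceeds a valid bandwidth `w₀`; this is how the geometric estimate enters the cost. -/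
theorem run_bandwidthProg {w₀ : ℕ} (h : HasInput ℓ n R C v s) (hn : n ≤ M) (hw : 1 ≤ w₀)
    (hwM : w₀ ≤ M) (hR : ∀ p < n, R p + 1 ≤ M ∧ C p ≤ M ∧ R p < C p + w₀) :
    Run M bandwidthProg s (n * 37 + 7) fun s' => HasInput ℓ n R C v s' ∧
      1 ≤ s'.ivar 3 ∧ s'.ivar 3 ≤ w₀ ∧ ∀ p < n, R p < C p + s'.ivar 3 := by
  refine Run.iset_seq (by simp [IExpr.Ok]; omega) (by simp [IExpr.cost]) ?_
  refine Run.iset_seq (by simp [IExpr.Ok]) (by simp [IExpr.cost]) ?_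
  refine Run.mono (Run.loop (fun k s' => s'.ivar 4 = k ∧ HasInput ℓ n R C v s' ∧
      1 ≤ s'.ivar 3 ∧ s'.ivar 3 ≤ w₀ ∧ ∀ p < k, R p < C p + s'.ivar 3) 0 n (Nat.zero_le _)
      -- One pass costs at most 30 for the conditional update, 4 for the counter and 3 for the loop
      -- test, whence the factor 37.
      (T := 34) ?_ ?_ ?_) ?_ fun s' h' => h'.2
  · rintro k s' hk ⟨hk', hin, h1, h2, h3⟩
    simp only [Test.Ok, IExpr.Ok, Test.Holds, IExpr.eval, hk', hin.num, iff_self, and_true]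
    omega
  · rintro k s' - hk ⟨hk', hin, h1, h2, h3⟩
    obtain ⟨b1, b2, b3⟩ := hR k hk
    refine Run.seq (T₁ := 30) (T₂ := 4) (Run.ite ?_ (by decide) (fun ht => ?_) fun ht => ?_)
    · simp only [Test.Ok, IExpr.Ok, IExpr.eval, hk', hin.row, hin.col]
      omega
    · simp only [Test.Holds, IExpr.eval, hk', hin.row, hin.col] at ht
      refine Run.iset ?_ (by decide) (Run.iset ?_ (by decide) ?_)
      · simp only [IExpr.Ok, IExpr.eval, hk', hin.row, hin.col]
        omega
      · simp [IExpr.Ok, IExpr.eval, hk']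
        omega
      · refine ⟨by simp [IExpr.eval, hk'], ⟨?_, ?_, ?_, ?_, ?_⟩, ?_, ?_, fun p hp => ?_⟩ <;>
          simp [IExpr.eval, hk', hin.row, hin.col, hin.size, hin.num, hin.val]
        · omega
        · omega
        · rcases (Nat.lt_succ_iff.1 hp).eq_or_lt with rfl | hp
          · omega
          · have := h3 p hp
            omega
    · simp only [Test.Holds, IExpr.eval, hk', hin.row, hin.col] at ht
      refine Run.skip (Run.iset ?_ (by decide) ?_)
      · simp [IExpr.Ok, IExpr.eval, hk']
        omega
      · refine ⟨by simp [IExpr.eval, hk'], ⟨?_, ?_, ?_, ?_, ?_⟩, ?_, ?_, fun p hp => ?_⟩ <;>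
          simp [hin.row, hin.col, hin.size, hin.num, hin.val, h1, h2]
        rcases (Nat.lt_succ_iff.1 hp).eq_or_lt with rfl | hp
        · omega
        · exact h3 p hp
  · refine ⟨by simp [IExpr.eval], ⟨?_, ?_, ?_, ?_, ?_⟩, ?_, ?_, ?_⟩ <;>
      simp [IExpr.eval, h.row, h.col, h.size, h.num, h.val, hw]
  · simp [IExpr.cost, Test.cost]

theorem run_zeroProg (h : HasInput ℓ n R C v s) (hw : s.ivar 3 = w) (hw1 : 1 ≤ w) (hℓ : 1 ≤ ℓ)
    (hM : ℓ * w ≤ M) :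
    Run M zeroProg s (ℓ * w * 13 + 7) fun s' => HasInput ℓ n R C v s' ∧
      s'.ivar 3 = w ∧ ∀ p < ℓ * w, s'.rarr 2 p = 0 := by
  have hwM : w ≤ M := (Nat.le_mul_of_pos_left w hℓ).trans hM
  have hℓM : ℓ ≤ M := (Nat.le_mul_of_pos_right ℓ hw1).trans hM
  refine Run.iset_seq (by simp [IExpr.Ok]) (by simp [IExpr.cost]) ?_
  refine Run.mono (Run.loop (fun k s' => s'.ivar 4 = k ∧ HasInput ℓ n R C v s' ∧
      s'.ivar 3 = w ∧ ∀ p < k, s'.rarr 2 p = 0) 0 (ℓ * w) (Nat.zero_le _)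
      (T := 8) ?_ ?_ ?_) ?_ fun s' h' => h'.2
  · rintro k s' hk ⟨hk', hin, h1, h2⟩
    simp only [Test.Ok, IExpr.Ok, Test.Holds, IExpr.eval, hk', hin.size, h1, iff_self,
      and_true]
    omega
  · rintro k s' - hk ⟨hk', hin, h1, h2⟩
    refine Run.rwrite_seq ?_ ?_ (by decide) (Run.iset ?_ (by decide) ?_)
    · simp only [IExpr.Ok, hk']
      omega
    · simp [RExpr.Ok]
    · simp [IExpr.Ok, IExpr.eval, hk']
      omega
    · refine ⟨by simp [IExpr.eval, hk'], ⟨?_, ?_, ?_, ?_, ?_⟩, ?_, fun p hp => ?_⟩ <;>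
        simp [IExpr.eval, RExpr.eval, hk', hin.row, hin.col, hin.size, hin.num, hin.val, h1,
          Function.update_apply]
      intro hpk
      exact h2 p (by omega)
  · refine ⟨by simp [IExpr.eval], ⟨?_, ?_, ?_, ?_, ?_⟩, ?_, ?_⟩ <;>
      simp [h.row, h.col, h.size, h.num, h.val, hw]
  · simp [IExpr.cost, Test.cost]

theorem run_scatterProg (h : HasInput ℓ n R C v s) (hw : s.ivar 3 = w) (hw1 : 1 ≤ w)
    (hℓ : 1 ≤ ℓ) (hM : ℓ * w ≤ M) (hn : n ≤ M) (h0 : ∀ p < ℓ * w, s.rarr 2 p = 0)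
    {E : ℕ → ℕ → ℝ} (hR : ∀ p < n, R p < ℓ ∧ C p < ℓ ∧ R p < C p + w ∧ v p = E (R p) (C p))
    (hE : ∀ i < ℓ, ∀ j < ℓ, E i j ≠ 0 → ∃ p < n, R p = i ∧ C p = j) :
    Run M scatterProg s (n * 37 + 5) fun s' => s'.ivar 0 = ℓ ∧ s'.ivar 3 = w ∧
      ∀ i < ℓ, ∀ a < w, a ≤ i → s'.rarr 2 (i * w + a) = E i (i - a) := by
  classical
  have hwM : w ≤ M := (Nat.le_mul_of_pos_left w hℓ).trans hM
  have hℓM : ℓ ≤ M := (Nat.le_mul_of_pos_right ℓ hw1).trans hM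
  refine Run.iset_seq (by simp [IExpr.Ok]) (by simp [IExpr.cost]) ?_
  -- After `k` list items a cell holds its element if one of these items names its position, and
  -- zero otherwise. At the end an unnamed position is one where `E` vanishes.
  refine Run.mono (Run.loop (fun k s' => s'.ivar 4 = k ∧ HasInput ℓ n R C v s' ∧
      s'.ivar 3 = w ∧ ∀ i < ℓ, ∀ a < w, a ≤ i → s'.rarr 2 (i * w + a) =
        if ∃ p < k, R p = i ∧ C p = i - a then E i (i - a) else 0) 0 n (Nat.zero_le _)
      (T := 34) ?_ ?_ ?_) ?_ ?_
  · rintro k s' hk ⟨hk', hin, h1, h2⟩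
    simp only [Test.Ok, IExpr.Ok, Test.Holds, IExpr.eval, hk', hin.num, iff_self, and_true]
    omega
  · rintro k s' - hk ⟨hk', hin, h1, h2⟩
    obtain ⟨b1, b2, b3, b4⟩ := hR k hk
    refine Run.seq (T₁ := 30) (T₂ := 4) (Run.ite ?_ (by decide) (fun ht => ?_) fun ht => ?_)
    · simp only [Test.Ok, IExpr.Ok, IExpr.eval, hk', hin.row, hin.col]
      omega
    · simp only [Test.Holds, IExpr.eval, hk', hin.row, hin.col] at ht
      refine Run.skip (Run.iset ?_ (by decide) ?_)
      · simp [IExpr.Ok, IExpr.eval, hk']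
        omega
      · refine ⟨by simp [IExpr.eval, hk'], ⟨?_, ?_, ?_, ?_, ?_⟩, ?_, fun i hi a ha hai => ?_⟩ <;>
          simp only [State.setI_ivar, State.setI_iarr, State.setI_rarr, hin.row, hin.col, hin.size,
            hin.num, hin.val, h1, ↓reduceIte, OfNat.zero_ne_ofNat,
            OfNat.one_ne_ofNat, Nat.reduceEqDiff]
        rw [h2 i hi a ha hai]
        refine if_congr ⟨fun ⟨p, hp, hp'⟩ => ⟨p, by omega, hp'⟩, fun ⟨p, hp, hp1, hp2⟩ => ?_⟩ rfl rfl
        rcases (Nat.lt_succ_iff.1 hp).eq_or_lt with rfl | hp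
        · omega
        · exact ⟨p, hp, hp1, hp2⟩
    · simp only [Test.Holds, IExpr.eval, hk', hin.row, hin.col] at ht
      have haddr := band_addr_lt b1 (show R k - C k < w by omega)
      refine Run.rwrite ?_ ?_ (by decide) (Run.iset ?_ (by decide) ?_)
      · simp only [IExpr.Ok, IExpr.eval, hk', hin.row, hin.col, h1]
        omega
      · simp only [RExpr.Ok, IExpr.Ok, hk']
        omega
      · simp [IExpr.Ok, IExpr.eval, hk']
        omega
      · refine ⟨by simp [IExpr.eval, hk'], ⟨?_, ?_, ?_, ?_, ?_⟩, ?_, fun i hi a ha hai => ?_⟩ <;>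
          simp only [State.setI_ivar, State.setI_iarr, State.setI_rarr, State.writeR_ivar,
            State.writeR_iarr, State.writeR_rarr, hin.row, hin.col, hin.size,
            hin.num, hin.val, h1, ↓reduceIte, OfNat.zero_ne_ofNat,
            OfNat.one_ne_ofNat, Nat.reduceEqDiff, IExpr.eval, RExpr.eval, hk',
            Function.update_apply]
        by_cases hia : R k = i ∧ C k = i - a
        · rw [if_pos (by rw [hia.1, hia.2]; congr 1; omega), if_pos ⟨k, by omega, hia⟩, b4, hia.1,
            hia.2]
        · rw [if_neg, h2 i hi a ha hai]
          · refine if_congr ⟨fun ⟨p, hp, hp'⟩ => ⟨p, by omega, hp'⟩, fun ⟨p, hp, hp'⟩ => ?_⟩ rfl rfl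
            rcases (Nat.lt_succ_iff.1 hp).eq_or_lt with rfl | hp
            · exact absurd hp' hia
            · exact ⟨p, hp, hp'⟩
          · intro heq
            obtain ⟨e1, e2⟩ := band_addr_inj ha (by omega) heq
            omega
  · refine ⟨by simp [IExpr.eval], ⟨?_, ?_, ?_, ?_, ?_⟩, ?_, ?_⟩ <;>
      simp [h.row, h.col, h.size, h.num, h.val, hw]
    exact fun i hi a ha _ => h0 _ (band_addr_lt hi ha)
  · simp [IExpr.cost, Test.cost]
  · rintro s' ⟨-, hin, h1, h2⟩
    refine ⟨hin.size, h1, fun i hi a ha hai => ?_⟩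
    rw [h2 i hi a ha hai]
    split_ifs with hp
    · rfl
    · by_contra hne
      exact hp (hE i hi (i - a) (by omega) (Ne.symm hne))

end RealRAM

/-! ### The banded factorization in place. -/

namespace RealRAM

/-- The address of the current cell `(5, 6)` of the band array. -/
def cellAddr : IExpr := .add (.mul (.var 5) (.var 3)) (.var 6)

/-- Subtracts from the real variable `0` the contributions of the finished columns. -/
def dotProg : Prog :=
  .loop (.ilt (.var 7) (.var 8)) <|
    .seq (.rset 0 (.sub (.var 0) (.mul
      (.read 2 (.add (.mul (.var 7) (.var 3)) (.sub (.var 7) (.sub (.var 5) (.var 6)))))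
      (.read 2 (.add (.mul (.var 7) (.var 3)) (.sub (.var 7) (.var 5)))))))
      (.iset 7 (.add (.var 7) (.const 1)))

/-- Prepares the computation of a cell: the loop bounds and the initial value. -/
def initProg : Prog :=
  .seq (.iset 8 (.add (.sub (.var 5) (.var 6)) (.var 3))) <|
  .seq (.ite (.ilt (.var 0) (.var 8)) (.iset 8 (.var 0)) .skip) <|
  .seq (.rset 0 (.read 2 cellAddr)) (.iset 7 (.add (.var 5) (.const 1)))

/-- Stores the computed cell. -/
def storeProg : Prog :=
  .ite (.ilt (.const 0) (.var 6))
    (.rwrite 2 cellAddr (.div (.var 0) (.read 2 (.mul (.var 5) (.var 3)))))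
    (.rwrite 2 cellAddr (.sqrt (.var 0)))

/-- Computes one cell of the band array. -/
def cellProg : Prog :=
  .seq (.ite (.ilt (.var 5) (.var 6)) .skip (.seq initProg (.seq dotProg storeProg)))
    (.iset 6 (.add (.var 6) (.const 1)))

/-- The reverse Cholesky factorization of the band array. -/
def factorProg : Prog :=
  .seq (.iset 5 (.var 0)) <| .loop (.ilt (.const 0) (.var 5)) <|
    .seq (.iset 5 (.sub (.var 5) (.const 1))) <| .seq (.iset 6 (.const 0)) <|
      .loop (.ilt (.var 6) (.var 3)) cellProg

variable {M ℓ w u a : ℕ} {s : State} {f : ℕ → ℝ} {V W : ℕ → ℕ → ℝ}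

/-- The state while the cell `(u, a)` of the band array `f` is processed. -/
structure AtCell (ℓ w u a : ℕ) (f : ℕ → ℝ) (s : State) : Prop where
  size : s.ivar 0 = ℓ
  width : s.ivar 3 = w
  col : s.ivar 5 = u
  off : s.ivar 6 = a
  arr : s.rarr 2 = f

/-- With row `j = u - a`, the two cells read in column `k` are those of `V j k` and `V u k`. The
bound `e ≤ u - a + w` keeps both offsets below `w`, hence inside column `k`. -/
theorem run_dotProg {e : ℕ} {x : ℝ} (h : AtCell ℓ w u a f s) (hM : ℓ * w ≤ M) (hw1 : 1 ≤ w)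
    (h7 : s.ivar 7 = u + 1) (h8 : s.ivar 8 = e) (hue : u + 1 ≤ e) (heℓ : e ≤ ℓ)
    (hew : e ≤ u - a + w) (hx : s.rvar 0 = x) (hau : a ≤ u) :
    Run M dotProg s (w * 29 + 3) fun s' => AtCell ℓ w u a f s' ∧
      s'.rvar 0 = x - ∑ k ∈ Finset.Ico (u + 1) e,
        f (k * w + (k - (u - a))) * f (k * w + (k - u)) := by
  have hℓM : ℓ ≤ M := (Nat.le_mul_of_pos_right ℓ hw1).trans hM
  have hwM : w ≤ M := (Nat.le_mul_of_pos_left w (by omega)).trans hM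
  refine Run.mono (Run.loop (fun k s' => s'.ivar 7 = k ∧ s'.ivar 8 = e ∧ AtCell ℓ w u a f s' ∧
      s'.rvar 0 = x - ∑ k ∈ Finset.Ico (u + 1) k,
        f (k * w + (k - (u - a))) * f (k * w + (k - u))) (u + 1) e hue
      (T := 26) ?_ ?_ ⟨h7, h8, h, by simp [hx]⟩) ?_ fun s' h' => h'.2.2
  · rintro k s' hk ⟨hk', h8, hc, -⟩
    simp only [Test.Ok, IExpr.Ok, Test.Holds, IExpr.eval, hk', h8, iff_self, and_true]
    omega
  · rintro k s' huk hk ⟨hk', h8, hc, hsum⟩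
    have h1 := band_addr_lt (show k < ℓ by omega) (show k - (u - a) < w by omega)
    have h2 := band_addr_lt (show k < ℓ by omega) (show k - u < w by omega)
    refine Run.rset_seq ?_ (by decide) (Run.iset ?_ (by decide) ?_)
    · simp only [RExpr.Ok, IExpr.Ok, IExpr.eval, hk', hc.width, hc.col, hc.off, true_and]
      omega
    · simp only [IExpr.Ok, IExpr.eval, State.setR_ivar, hk']
      omega
    · refine ⟨by simp [IExpr.eval, hk'], by simp [h8], ⟨?_, ?_, ?_, ?_, ?_⟩, ?_⟩ <;>
        simp [hc.size, hc.width, hc.col, hc.off, hc.arr]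
      rw [Finset.sum_Ico_succ_top huk]
      simp [RExpr.eval, IExpr.eval, hk', hc.width, hc.col, hc.off, hc.arr, hsum]
      ring
  · simp only [IExpr.cost, Test.cost]
    have : e - (u + 1) ≤ w := by omega
    omega

theorem run_initProg (h : AtCell ℓ w u a f s) (hM : 2 * (ℓ * w) ≤ M) (hu : u < ℓ) (ha : a < w)
    (hau : a ≤ u) :
    Run M initProg s 40 fun s' => AtCell ℓ w u a f s' ∧ s'.ivar 7 = u + 1 ∧
      s'.ivar 8 = min (u - a + w) ℓ ∧ s'.rvar 0 = f (u * w + a) := by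
  have hℓM : ℓ ≤ ℓ * w := Nat.le_mul_of_pos_right ℓ (by omega)
  have hwM : w ≤ ℓ * w := Nat.le_mul_of_pos_left w (by omega)
  have haddr := band_addr_lt hu ha
  -- The value `u - a + w` is formed before it is capped at `ℓ`. It can exceed `ℓ * w` but not `ℓ +
  -- w ≤ 2 * (ℓ * w)`, one reason for the factor 2 in the memory bound.
  refine Run.iset_seq ?_ (by decide) ?_
  · simp only [IExpr.Ok, IExpr.eval, h.width, h.col, h.off]
    omega
  refine Run.mono (Run.seq (T₁ := 10) (T₂ := 20) (Q := fun s' => AtCell ℓ w u a f s' ∧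
      s'.ivar 7 = u + 1 ∧ s'.ivar 8 = min (u - a + w) ℓ ∧ s'.rvar 0 = f (u * w + a))
    (Run.mono (T₁ := 10) (Q := fun s' => AtCell ℓ w u a f s' ∧ s'.ivar 8 = min (u - a + w) ℓ)
      (Run.ite ?_ (by decide) (fun ht => Run.iset ?_ (by decide) ?_) fun ht => Run.skip ?_) le_rfl
      fun s' ⟨hc, h8⟩ => Run.rset_seq ?_ (by decide) (Run.iset ?_ (by decide) ?_))) (by decide)
    fun _ => id
  · simp [Test.Ok, IExpr.Ok, IExpr.eval, h.size, h.width, h.col, h.off]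
    omega
  · simp [IExpr.Ok, h.size]
    omega
  · simp [Test.Holds, IExpr.eval, h.size, h.width, h.col, h.off] at ht
    refine ⟨⟨?_, ?_, ?_, ?_, ?_⟩, ?_⟩ <;>
      simp [IExpr.eval, h.size, h.width, h.col, h.off, h.arr]
    omega
  · simp [Test.Holds, IExpr.eval, h.size, h.width, h.col, h.off] at ht
    refine ⟨⟨?_, ?_, ?_, ?_, ?_⟩, ?_⟩ <;>
      simp [IExpr.eval, h.size, h.width, h.col, h.off, h.arr]
    omega
  · simp only [cellAddr, RExpr.Ok, IExpr.Ok, IExpr.eval, hc.width, hc.col, hc.off]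
    have : u * w ≤ u * w + a := Nat.le_add_right _ _
    omega
  · simp only [IExpr.Ok, IExpr.eval, State.setR_ivar, hc.col]
    omega
  · refine ⟨⟨?_, ?_, ?_, ?_, ?_⟩, ?_, ?_, ?_⟩ <;>
      simp [cellAddr, IExpr.eval, RExpr.eval, hc.size, hc.width, hc.col, hc.off, hc.arr, h8]

/-- The offset `a = 0` comes first and takes a square root; each later offset divides by the
diagonal element already stored at `u * w`. -/
theorem run_storeProg {x y : ℝ} (h : AtCell ℓ w u a f s) (hM : ℓ * w ≤ M) (hu : u < ℓ)
    (ha : a < w) (hx : s.rvar 0 = x) (hy : 0 < y) (h0 : a = 0 → x = y * y)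
    (h1 : 0 < a → f (u * w) ≠ 0 ∧ x / f (u * w) = V (u - a) u) (h0' : a = 0 → V u u = y) :
    Run M storeProg s 20 fun s' => AtCell ℓ w u a (Function.update f (u * w + a) (V (u - a) u)) s' := by
  have hℓM : ℓ ≤ ℓ * w := Nat.le_mul_of_pos_right ℓ (by omega)
  have hwM : w ≤ ℓ * w := Nat.le_mul_of_pos_left w (by omega)
  have haddr := band_addr_lt hu ha
  have haddrOk : IExpr.Ok M s cellAddr := by
    simp only [cellAddr, IExpr.Ok, IExpr.eval, h.width, h.col, h.off]
    omega
  refine Run.ite ?_ (by decide) (fun ht => ?_) fun ht => ?_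
  · simp only [Test.Ok, IExpr.Ok, h.off]
    omega
  · simp only [Test.Holds, IExpr.eval, h.off] at ht
    obtain ⟨h2, h3⟩ := h1 ht
    refine Run.rwrite haddrOk ?_ (by decide) ⟨?_, ?_, ?_, ?_, ?_⟩
    · simp only [RExpr.Ok, IExpr.Ok, IExpr.eval, RExpr.eval, h.width, h.col, h.arr, true_and]
      exact ⟨by omega, h2⟩
    all_goals simp [cellAddr, IExpr.eval, RExpr.eval, h.size, h.width, h.col, h.off, h.arr, hx, h3]
  · simp only [Test.Holds, IExpr.eval, h.off, not_lt, nonpos_iff_eq_zero] at ht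
    refine Run.rwrite haddrOk ?_ (by decide) ⟨?_, ?_, ?_, ?_, ?_⟩
    · simp only [RExpr.Ok, RExpr.eval, hx, h0 ht, true_and]
      positivity
    all_goals simp [cellAddr, IExpr.eval, RExpr.eval, h.size, h.width, h.col, h.off, h.arr, hx]
    rw [h0 ht, Real.sqrt_mul_self hy.le, ht, Nat.sub_zero, h0' ht]

/-- The band array `f` contains the elements of `V` in the finished cells and those of `W` in the
other cells. -/
def BandArray (ℓ w : ℕ) (V W : ℕ → ℕ → ℝ) (done : ℕ → ℕ → Prop) (f : ℕ → ℝ) : Prop :=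
  ∀ i < ℓ, ∀ b < w, b ≤ i → (done i b → f (i * w + b) = V (i - b) i) ∧
    (¬ done i b → f (i * w + b) = W i (i - b))

theorem BandArray.congr {D D' : ℕ → ℕ → Prop} (h : BandArray ℓ w V W D f)
    (hD : ∀ i < ℓ, ∀ b < w, b ≤ i → (D' i b ↔ D i b)) : BandArray ℓ w V W D' f := by
  intro i hi b hb hbi
  rw [hD i hi b hb hbi]
  exact h i hi b hb hbi

theorem BandArray.update {D D' : ℕ → ℕ → Prop} (h : BandArray ℓ w V W D f) (ha : a < w)
    (hD : ∀ i b, D' i b ↔ D i b ∨ (i = u ∧ b = a)) :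
    BandArray ℓ w V W D' (Function.update f (u * w + a) (V (u - a) u)) := by
  intro i hi b hb hbi
  rw [hD]
  by_cases hib : i = u ∧ b = a
  · obtain ⟨rfl, rfl⟩ := hib
    simp
  · rw [Function.update_of_ne fun h => hib (band_addr_inj hb ha h)]
    simpa [hib] using h i hi b hb hbi

/-- The recursion of the banded reverse Cholesky algorithm. -/
structure BandRecursion (ℓ w : ℕ) (V W : ℕ → ℕ → ℝ) : Prop where
  diag_pos : ∀ i < ℓ, 0 < V i i
  mul_diag : ∀ i < ℓ, ∀ j ≤ i, V j i * V i i =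
    W i j - ∑ k ∈ Finset.Ico (i + 1) (min (j + w) ℓ), V j k * V i k

theorem run_cellProg (hV : BandRecursion ℓ w V W) (h : AtCell ℓ w u a f s)
    (hM : 2 * (ℓ * w) ≤ M) (hu : u < ℓ) (ha : a < w)
    (hf : BandArray ℓ w V W (fun i b => u < i ∨ i = u ∧ b < a) f) :
    Run M cellProg s (w * 29 + 80) fun s' => ∃ f', AtCell ℓ w u (a + 1) f' s' ∧
      BandArray ℓ w V W (fun i b => u < i ∨ i = u ∧ b < a + 1) f' := by
  have hℓM : ℓ ≤ ℓ * w := Nat.le_mul_of_pos_right ℓ (by omega)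
  have hwM : w ≤ ℓ * w := Nat.le_mul_of_pos_left w (by omega)
  have hstep : ∀ f' s', AtCell ℓ w u a f' s' →
      BandArray ℓ w V W (fun i b => u < i ∨ i = u ∧ b < a + 1) f' →
      Run M (.iset 6 (.add (.var 6) (.const 1))) s' 4 fun s' => ∃ f', AtCell ℓ w u (a + 1) f' s' ∧
      BandArray ℓ w V W (fun i b => u < i ∨ i = u ∧ b < a + 1) f' := by
    intro f' s' hc hf'
    refine Run.iset ?_ (by decide) ⟨f', ⟨?_, ?_, ?_, ?_, ?_⟩, hf'⟩
    · simp only [IExpr.Ok, IExpr.eval, hc.off]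
      omega
    all_goals simp [IExpr.eval, hc.size, hc.width, hc.col, hc.off, hc.arr]
  refine Run.mono (Run.seq (T₁ := w * 29 + 70) (T₂ := 4) (Run.ite ?_ ?_ (fun ht => ?_) fun ht => ?_))
    (by omega) fun _ => id
  · simp only [Test.Ok, IExpr.Ok, h.col, h.off]
    omega
  · simp [Test.cost, IExpr.cost]
  · simp only [Test.Holds, IExpr.eval, h.col, h.off] at ht
    -- For `u < a` the cell would lie above row `0`; `BandArray` says nothing about such cells.
    exact Run.skip (hstep f s h (hf.congr fun i _ b _ _ => by omega))
  · simp only [Test.Holds, IExpr.eval, h.col, h.off, not_lt] at ht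
    have hrec := hV.mul_diag u hu (u - a) (by omega)
    refine Run.mono (Run.seq (T₁ := 40) (T₂ := w * 29 + 3 + 20) (Run.mono
      (run_initProg h hM hu ha ht) le_rfl fun s₁ ⟨hc, h7, h8, hx⟩ => Run.seq (Run.mono
        (run_dotProg hc (by omega) (by omega) h7 h8 (by omega) (by omega) (by omega) hx ht) le_rfl
        fun s₂ ⟨hc, hx⟩ => Run.mono (run_storeProg (x := V (u - a) u * V u u) (y := V u u) hc
          (by omega) hu ha ?_ (hV.diag_pos u hu) ?_ ?_ fun _ => rfl)
          le_rfl fun s₃ hc => hstep _ _ hc ?_))) ?_ fun _ => id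
    -- The current cell still holds `W`, while all columns to the right already hold `V`, so the
    -- computed difference is the right side of the recursion.
    · rw [hx, hrec, (hf u hu a ha ht).2 (by omega)]
      congr 1
      refine Finset.sum_congr rfl fun k hk => ?_
      rw [Finset.mem_Ico] at hk
      rw [(hf k (by omega) (k - (u - a)) (by omega) (by omega)).1 (by omega),
        (hf k (by omega) (k - u) (by omega) (by omega)).1 (by omega)]
      congr 2 <;> omega
    · rintro rfl
      rfl
    · intro ha0
      have hd : f (u * w) = V u u := by
        simpa using (hf u hu 0 (by omega) (by omega)).1 (by omega)
      have := (hV.diag_pos u hu).ne'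
      rw [hd]
      exact ⟨this, mul_div_cancel_right₀ _ this⟩
    · exact hf.update ha fun i b => by omega
    · simp [Test.cost, IExpr.cost]
      omega

theorem run_factorProg (hV : BandRecursion ℓ w V W) (hℓ : s.ivar 0 = ℓ) (hw : s.ivar 3 = w)
    (hw1 : 1 ≤ w) (hℓ1 : 1 ≤ ℓ) (hM : 2 * (ℓ * w) ≤ M)
    (hf : BandArray ℓ w V W (fun _ _ => False) (s.rarr 2)) :
    Run M factorProg s (ℓ * (w * (w * 29 + 83) + 12) + 5) fun s' => s'.ivar 0 = ℓ ∧ s'.ivar 3 = w ∧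
      BandArray ℓ w V W (fun _ _ => True) (s'.rarr 2) := by
  have hℓM : ℓ ≤ ℓ * w := Nat.le_mul_of_pos_right ℓ (by omega)
  have hwM : w ≤ ℓ * w := Nat.le_mul_of_pos_left w (by omega)
  refine Run.iset_seq (by simp [IExpr.Ok, hℓ]; omega) (by simp [IExpr.cost]) ?_
  -- The invariant counts finished columns: after `k` of them the index variable `5` equals `ℓ - k`,
  -- and it is decremented before the next column is processed.
  refine Run.mono (Run.loop (fun k s' => s'.ivar 0 = ℓ ∧ s'.ivar 3 = w ∧ s'.ivar 5 = ℓ - k ∧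
    BandArray ℓ w V W (fun i _ => ℓ - k ≤ i) (s'.rarr 2)) 0 ℓ (Nat.zero_le _)
    (T := w * (w * 29 + 83) + 9) ?_ ?_ ?_) ?_ fun s' h' => ⟨h'.1, h'.2.1, h'.2.2.2.congr
      fun _ _ _ _ _ => by simp⟩
  · rintro k s' hk ⟨h0, h3, h5, -⟩
    simp only [Test.Ok, IExpr.Ok, Test.Holds, IExpr.eval, h5]
    omega
  · rintro k s' - hk ⟨h0, h3, h5, hf⟩
    refine Run.iset_seq ?_ ?_ (Run.iset_seq ?_ ?_ (Run.mono (Run.loop (fun a s' => ∃ f',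
      AtCell ℓ w (ℓ - (k + 1)) a f' s' ∧ BandArray ℓ w V W
        (fun i b => ℓ - (k + 1) < i ∨ i = ℓ - (k + 1) ∧ b < a) f') 0 w (Nat.zero_le _)
        (T := w * 29 + 80) ?_ ?_ ?_) ?_ ?_))
    · simp only [IExpr.Ok, h5]
      omega
    · simp [IExpr.cost]
    · simp [IExpr.Ok]
    · simp [IExpr.cost]
    · rintro a s'' ha ⟨f', hc, -⟩
      simp only [Test.Ok, IExpr.Ok, Test.Holds, IExpr.eval, hc.off, hc.width, iff_self,
        and_true]
      omega
    · rintro a s'' - ha ⟨f', hc, hf'⟩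
      exact run_cellProg hV hc hM (by omega) ha hf'
    · refine ⟨s'.rarr 2, ⟨?_, ?_, ?_, ?_, ?_⟩, hf.congr fun i _ b _ _ => by omega⟩ <;>
        simp [IExpr.eval, h0, h3, h5]
      omega
    · simp [Test.cost, IExpr.cost]
    · rintro s'' ⟨f', hc, hf'⟩
      refine ⟨hc.size, hc.width, hc.col, ?_⟩
      rw [hc.arr]
      exact hf'.congr fun i _ b _ _ => by omega
  · refine ⟨?_, ?_, ?_, ?_⟩ <;> simp [IExpr.eval, hℓ, hw]
    exact hf.congr fun i _ b _ _ => by simp; omega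
  · simp [Test.cost, IExpr.cost]

end RealRAM

/-! ### Listing the nonzero elements of the factor. -/

namespace RealRAM

/-- A list of length `n` of the positions and values of the nonzero elements of `E` in `D`. -/
structure Lists (E : ℕ → ℕ → ℝ) (D : ℕ → ℕ → Prop) (n : ℕ) (r c : ℕ → ℕ) (x : ℕ → ℝ) : Prop where
  mem : ∀ p < n, D (r p) (c p) ∧ x p = E (r p) (c p) ∧ E (r p) (c p) ≠ 0
  cover : ∀ i j, D i j → E i j ≠ 0 → ∃! p, p < n ∧ r p = i ∧ c p = j

namespace Lists

variable {E : ℕ → ℕ → ℝ} {D D' : ℕ → ℕ → Prop} {n i j : ℕ} {r c : ℕ → ℕ} {x : ℕ → ℝ}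

theorem congr (h : Lists E D n r c x) (hD : ∀ i j, D' i j ↔ D i j) : Lists E D' n r c x := by
  rwa [show D' = D by funext i j; exact propext (hD i j)]

theorem skip (h : Lists E D n r c x) (hE : E i j = 0)
    (hD : ∀ i' j', D' i' j' ↔ D i' j' ∨ (i' = i ∧ j' = j)) : Lists E D' n r c x := by
  refine ⟨fun p hp => ⟨(hD _ _).2 (Or.inl (h.mem p hp).1), (h.mem p hp).2⟩, fun i' j' hij hne => ?_⟩
  rcases (hD _ _).1 hij with hij | ⟨rfl, rfl⟩
  · exact h.cover _ _ hij hne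
  · exact absurd hE hne

/-- Each position stays listed only once because the old items lie in `D` and the new one does not.
-/
theorem append (h : Lists E D n r c x) (hE : E i j ≠ 0) (hij : ¬ D i j)
    (hD : ∀ i' j', D' i' j' ↔ D i' j' ∨ (i' = i ∧ j' = j)) :
    Lists E D' (n + 1) (Function.update r n i) (Function.update c n j)
      (Function.update x n (E i j)) := by
  refine ⟨fun p hp => ?_, fun i' j' hij' hne => ?_⟩
  · rcases (Nat.lt_succ_iff.1 hp).eq_or_lt with rfl | hp
    · simpa [hE] using (hD _ _).2 (Or.inr ⟨rfl, rfl⟩)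
    · simp only [Function.update_of_ne hp.ne]
      exact ⟨(hD _ _).2 (Or.inl (h.mem p hp).1), (h.mem p hp).2⟩
  · rcases (hD _ _).1 hij' with hd | ⟨rfl, rfl⟩
    · obtain ⟨p, ⟨hp, hr, hc⟩, huniq⟩ := h.cover _ _ hd hne
      refine ⟨p, ⟨by omega, by simpa [Function.update_of_ne hp.ne] using ⟨hr, hc⟩⟩, ?_⟩
      rintro p' ⟨hp', hr', hc'⟩
      rcases (Nat.lt_succ_iff.1 hp').eq_or_lt with rfl | hp'
      · simp only [Function.update_self] at hr' hc'
        subst hr' hc'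
        exact absurd hd hij
      · simp only [Function.update_of_ne hp'.ne] at hr' hc'
        exact huniq p' ⟨hp', hr', hc'⟩
    · refine ⟨n, ⟨by omega, by simp⟩, ?_⟩
      rintro p' ⟨hp', hr', hc'⟩
      rcases (Nat.lt_succ_iff.1 hp').eq_or_lt with rfl | hp'
      · rfl
      · simp only [Function.update_of_ne hp'.ne] at hr' hc'
        have := (h.mem p' hp').1
        rw [hr', hc'] at this
        exact absurd this hij

end Lists

/-- Appends one cell of the band array to the output if it is nonzero. -/
def emitCellProg : Prog :=
  .seq (.ite (.ilt (.var 5) (.var 6)) .skip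
    (.ite (.req (.read 2 cellAddr) (.const 0)) .skip
      (.seq (.iwrite 2 (.var 2) (.sub (.var 5) (.var 6)))
      (.seq (.iwrite 3 (.var 2) (.var 5))
      (.seq (.rwrite 1 (.var 2) (.read 2 cellAddr))
      (.iset 2 (.add (.var 2) (.const 1))))))))
    (.iset 6 (.add (.var 6) (.const 1)))

/-- Lists the nonzero elements of the band array. -/
def emitProg : Prog :=
  .seq (.iset 2 (.const 0)) <| .seq (.iset 5 (.const 0)) <| .loop (.ilt (.var 5) (.var 0)) <|
    .seq (.iset 6 (.const 0)) <|
      .seq (.loop (.ilt (.var 6) (.var 3)) emitCellProg) (.iset 5 (.add (.var 5) (.const 1)))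

variable {M ℓ w u a : ℕ} {s : State} {f : ℕ → ℝ} {V W : ℕ → ℕ → ℝ}

/-- The cells that precede the cell `(u, a)` in the output. -/
def Emitted (ℓ w u a i j : ℕ) : Prop :=
  i ≤ j ∧ j < ℓ ∧ j < i + w ∧ (j < u ∨ (j = u ∧ j - i < a))

/-- The state of the output phase before the cell `(u, a)`. -/
structure EmitInv (ℓ w : ℕ) (V : ℕ → ℕ → ℝ) (f : ℕ → ℝ) (u a : ℕ) (s : State) : Prop where
  cell : AtCell ℓ w u a f s
  num : s.ivar 2 ≤ u * w + a
  lists : Lists V (Emitted ℓ w u a) (s.ivar 2) (s.iarr 2) (s.iarr 3) (s.rarr 1)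

theorem run_emitCellProg (h : EmitInv ℓ w V f u a s) (hM : 2 * (ℓ * w) ≤ M) (hu : u < ℓ)
    (ha : a < w) (hf : BandArray ℓ w V W (fun _ _ => True) f) :
    Run M emitCellProg s 44 (EmitInv ℓ w V f u (a + 1)) := by
  have hℓM : ℓ ≤ ℓ * w := Nat.le_mul_of_pos_right ℓ (by omega)
  have hwM : w ≤ ℓ * w := Nat.le_mul_of_pos_left w (by omega)
  have haddr := band_addr_lt hu ha
  obtain ⟨hc, hn, hl⟩ := h
  refine Run.seq (T₁ := 40) (T₂ := 4) (Run.ite ?_ (by decide) (fun ht => ?_) fun ht => ?_)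
  · simp only [Test.Ok, IExpr.Ok, hc.col, hc.off]
    omega
  · simp only [Test.Holds, IExpr.eval, hc.col, hc.off] at ht
    refine Run.skip (Run.iset ?_ (by decide) ⟨⟨?_, ?_, ?_, ?_, ?_⟩, ?_, ?_⟩)
    · simp only [IExpr.Ok, IExpr.eval, hc.off]
      omega
    all_goals simp [IExpr.eval, hc.size, hc.width, hc.col, hc.off, hc.arr]
    · omega
    · exact hl.congr fun i j => by simp only [Emitted]; omega
  · simp only [Test.Holds, IExpr.eval, hc.col, hc.off, not_lt] at ht
    have hval := (hf u hu a ha ht).1 trivial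
    -- Advancing by one cell adds exactly one position to the region covered, which is what
    -- `Lists.skip` and `Lists.append` require.
    have hD : ∀ i j, Emitted ℓ w u (a + 1) i j ↔ Emitted ℓ w u a i j ∨ (i = u - a ∧ j = u) := by
      intro i j
      simp only [Emitted]
      omega
    refine Run.ite ?_ (by decide) (fun ht' => ?_) fun ht' => ?_
    · simp only [Test.Ok, RExpr.Ok, cellAddr, IExpr.Ok, IExpr.eval, hc.col, hc.off, hc.width,
        and_true]
      omega
    · simp only [Test.Holds, RExpr.eval, cellAddr, IExpr.eval, hc.col, hc.off, hc.width, hc.arr,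
        hval, Int.cast_zero] at ht'
      refine Run.skip (Run.iset ?_ (by decide) ⟨⟨?_, ?_, ?_, ?_, ?_⟩, ?_, ?_⟩)
      · simp only [IExpr.Ok, IExpr.eval, hc.off]
        omega
      all_goals simp [IExpr.eval, hc.size, hc.width, hc.col, hc.off, hc.arr]
      · omega
      · exact hl.skip ht' hD
    · simp only [Test.Holds, RExpr.eval, cellAddr, IExpr.eval, hc.col, hc.off, hc.width, hc.arr,
        hval, Int.cast_zero] at ht'
      refine Run.iwrite_seq ?_ ?_ (by decide) (Run.iwrite_seq ?_ ?_ (by decide)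
        (Run.rwrite_seq ?_ ?_ (by decide) (Run.iset ?_ (by decide)
        (Run.iset ?_ (by decide) ⟨⟨?_, ?_, ?_, ?_, ?_⟩, ?_, ?_⟩))))
      · simp only [IExpr.Ok]
        omega
      · simp only [IExpr.Ok, hc.col, hc.off]
        omega
      · simp only [IExpr.Ok, State.writeI_ivar]
        omega
      · simp only [IExpr.Ok, State.writeI_ivar, hc.col]
        omega
      · simp only [IExpr.Ok, State.writeI_ivar]
        omega
      · simp only [RExpr.Ok, cellAddr, IExpr.Ok, IExpr.eval, State.writeI_ivar, hc.col, hc.off,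
          hc.width]
        omega
      · simp only [IExpr.Ok, IExpr.eval, State.writeI_ivar, State.writeR_ivar]
        omega
      · simp [IExpr.Ok, IExpr.eval, hc.off]
        omega
      all_goals simp [cellAddr, RExpr.eval, IExpr.eval, hc.size, hc.width, hc.col, hc.off, hc.arr]
      · omega
      · rw [hval]
        exact hl.append ht' (by simp only [Emitted]; omega) hD

theorem run_emitProg (hℓ : s.ivar 0 = ℓ) (hw : s.ivar 3 = w)
    (hw1 : 1 ≤ w) (hℓ1 : 1 ≤ ℓ) (hM : 2 * (ℓ * w) ≤ M)
    (hf : BandArray ℓ w V W (fun _ _ => True) (s.rarr 2)) :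
    Run M emitProg s (ℓ * (w * 47 + 12) + 7) fun s' =>
      Lists V (Emitted ℓ w ℓ 0) (s'.ivar 2) (s'.iarr 2) (s'.iarr 3) (s'.rarr 1) := by
  have hℓM : ℓ ≤ ℓ * w := Nat.le_mul_of_pos_right ℓ (by omega)
  have hwM : w ≤ ℓ * w := Nat.le_mul_of_pos_left w (by omega)
  refine Run.iset_seq (by simp [IExpr.Ok]) (by simp [IExpr.cost])
    (Run.iset_seq (by simp [IExpr.Ok]) (by simp [IExpr.cost]) ?_)
  refine Run.mono (Run.loop (fun u s' => s'.ivar 0 = ℓ ∧ s'.ivar 3 = w ∧ s'.ivar 5 = u ∧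
    s'.rarr 2 = s.rarr 2 ∧ s'.ivar 2 ≤ u * w ∧
    Lists V (Emitted ℓ w u 0) (s'.ivar 2) (s'.iarr 2) (s'.iarr 3) (s'.rarr 1)) 0 ℓ (Nat.zero_le _)
    (T := w * 47 + 9) ?_ ?_ ?_) ?_ fun s' h' => h'.2.2.2.2.2
  · rintro u s' hu ⟨h0, h3, h5, -⟩
    simp only [Test.Ok, IExpr.Ok, Test.Holds, IExpr.eval, h0, h5, iff_self, and_true]
    omega
  · rintro u s' - hu ⟨h0, h3, h5, harr, hn, hl⟩
    refine Run.iset_seq (by simp [IExpr.Ok]) (by simp [IExpr.cost]) (Run.mono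
      (Run.seq (T₁ := w * 47 + 3) (T₂ := 4) (Run.mono (Run.loop (EmitInv ℓ w V (s.rarr 2) u) 0 w
        (Nat.zero_le _) (T := 44) ?_ ?_ ?_) ?_ fun s'' ⟨hc, hn', hl'⟩ => Run.iset ?_ (by decide)
        ⟨?_, ?_, ?_, ?_, ?_, ?_⟩)) ?_ fun _ => id)
    · rintro a s'' ha ⟨hc, -, -⟩
      simp only [Test.Ok, IExpr.Ok, Test.Holds, IExpr.eval, hc.off, hc.width, iff_self, and_true]
      omega
    · rintro a s'' - ha h
      exact run_emitCellProg h hM hu ha hf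
    · refine ⟨⟨?_, ?_, ?_, ?_, ?_⟩, ?_, ?_⟩ <;> simp [IExpr.eval, h0, h3, h5, harr, hn, hl]
    · simp [Test.cost, IExpr.cost]
    · simp only [IExpr.Ok, IExpr.eval, hc.col]
      omega
    · simp [IExpr.cost]
    all_goals simp [IExpr.eval, hc.size, hc.width, hc.col, hc.arr]
    · rwa [Nat.succ_mul]
    · exact hl'.congr fun i j => by simp only [Emitted]; omega
  · refine ⟨?_, ?_, ?_, ?_, ?_, ?_⟩ <;> simp [IExpr.eval, hℓ, hw]
    exact ⟨fun p hp => absurd hp (Nat.not_lt_zero p), fun i j hij => by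
      simp only [Emitted] at hij; omega⟩
  · simp [Test.cost, IExpr.cost]

end RealRAM

/-! ### The complete program and its cost. -/

namespace RealRAM

open Vecchia

/-- The reverse Cholesky factorization of a sparse matrix. -/
def rcholProg : Prog :=
  .seq bandwidthProg <| .seq zeroProg <| .seq scatterProg <| .seq factorProg emitProg

variable {ℓ : ℕ} {W V : Matrix (Fin ℓ) (Fin ℓ) ℝ} {s : State}

/-- By symmetry a nonzero element satisfies `|i - j| < w`, so the row number and the shifted
difference `j + w - i` encode the list items injectively in a set of size `ℓ * (2 * w)`. The input
thus fits into the memory bound. -/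
theorem StoresSparse.num_le {x r c v w : ℕ} (h : StoresSparse s x r c v W)
    (hw : ∀ i j : Fin ℓ, W i j ≠ 0 → (i : ℕ) < j + w) (hsymm : ∀ i j, W i j = W j i) :
    s.ivar x ≤ 2 * (ℓ * w) := by
  have hcard : (Finset.range (s.ivar x)).card ≤
      (Finset.range ℓ ×ˢ Finset.range (2 * w)).card := by
    refine Finset.card_le_card_of_injOn
      (fun p => (s.iarr r p, s.iarr c p + w - s.iarr r p)) ?_ ?_
    · intro p hp
      obtain ⟨i, j, hi, hj, -, hne⟩ := h.1 p (Finset.mem_range.1 hp)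
      have h1 := hw i j hne
      have h2 := hw j i (by rwa [hsymm])
      simp only [Finset.coe_product, Finset.coe_range, Set.mem_prod, Set.mem_Iio, hi, hj]
      exact ⟨i.2, by omega⟩
    · intro p hp p' hp' heq
      obtain ⟨i, j, hi, hj, -, hne⟩ := h.1 p (Finset.mem_range.1 hp)
      obtain ⟨i', j', hi', hj', -, hne'⟩ := h.1 p' (Finset.mem_range.1 hp')
      simp only [hi, hj, hi', hj', Prod.mk.injEq] at heq
      have h1 := hw i j hne
      have h2 := hw i' j' hne'
      obtain rfl : i = i' := Fin.ext heq.1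
      obtain rfl : j = j' := Fin.ext (by omega)
      exact (h.2 i j hne).unique ⟨Finset.mem_range.1 hp, hi, hj⟩ ⟨Finset.mem_range.1 hp', hi', hj'⟩
  simp only [Finset.card_range, Finset.card_product] at hcard
  linarith [Nat.mul_left_comm ℓ 2 w]

theorem bandRecursion (h : IsRevCholeskyFactor W V) {w : ℕ}
    (hw : ∀ i j : Fin ℓ, W i j ≠ 0 → (i : ℕ) < j + w) :
    BandRecursion ℓ w (entry V) (entry W) :=
  ⟨fun _ hi => h.entry_diag_pos hi,
    fun _ hi _ hj => h.entry_mul_diag_of_band hw hi (hj.trans_lt hi)⟩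

theorem storesSparse_of_lists (h : IsRevCholeskyFactor W V) {w : ℕ}
    (hw : ∀ i j : Fin ℓ, W i j ≠ 0 → (i : ℕ) < j + w)
    (hl : Lists (entry V) (Emitted ℓ w ℓ 0) (s.ivar 2) (s.iarr 2) (s.iarr 3) (s.rarr 1)) :
    StoresSparse s 2 2 3 1 V := by
  refine ⟨fun p hp => ?_, fun i j hne => hl.cover i j ?_ (by simpa using hne)⟩
  · obtain ⟨⟨h1, h2, -⟩, h3, h4⟩ := hl.mem p hp
    have hlt : s.iarr 2 p < ℓ := by omega
    refine ⟨⟨_, hlt⟩, ⟨_, h2⟩, rfl, rfl, ?_, ?_⟩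
    · rw [h3, ← entry_fin V]
    · rwa [← entry_fin V]
  · have h1 : (i : ℕ) ≤ j := not_lt.1 fun hlt => hne (h.upper i j hlt)
    have h2 : (j : ℕ) < i + w := not_le.1 fun hle => hne (h.eq_zero_of_band hw hle)
    have := j.2
    simp only [Emitted]
    omega

theorem run_rcholProg (h : IsRevCholeskyFactor W V) {w₀ : ℕ}
    (hw₀ : ∀ i j : Fin ℓ, W i j ≠ 0 → (i : ℕ) < j + w₀) (hw1 : 1 ≤ w₀) (hℓ : 1 ≤ ℓ)
    (hs : s.ivar 0 = ℓ) (hW : StoresSparse s 1 0 1 0 W) :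
    Run (2 * (ℓ * w₀)) rcholProg s (400 * (ℓ * (w₀ * w₀))) fun s' => StoresSparse s' 2 2 3 1 V := by
  have hn := hW.num_le hw₀ h.symm
  set n := s.ivar 1 with hn_def
  have hℓX : ℓ ≤ ℓ * w₀ := Nat.le_mul_of_pos_right ℓ hw1
  have hwX : w₀ ≤ ℓ * w₀ := Nat.le_mul_of_pos_left w₀ hℓ
  have hXX : ℓ * w₀ ≤ ℓ * (w₀ * w₀) := Nat.mul_le_mul_left _ (Nat.le_mul_of_pos_left w₀ hw1)
  have hin : HasInput ℓ n (s.iarr 0) (s.iarr 1) (s.rarr 0) s := ⟨hs, rfl, rfl, rfl, rfl⟩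
  have hlist : ∀ p < n, s.iarr 0 p < ℓ ∧ s.iarr 1 p < ℓ ∧ s.iarr 0 p < s.iarr 1 p + w₀ ∧
      s.rarr 0 p = entry W (s.iarr 0 p) (s.iarr 1 p) ∧
      entry W (s.iarr 0 p) (s.iarr 1 p) ≠ 0 := by
    intro p hp
    obtain ⟨i, j, hi, hj, hv, hne⟩ := hW.1 p hp
    rw [hi, hj, entry_fin]
    exact ⟨i.2, j.2, hw₀ i j hne, hv, hne⟩
  refine Run.mono (Run.seq (T₁ := n * 37 + 7) (T₂ := (ℓ * w₀ * 13 + 7) + ((n * 37 + 5) +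
    ((ℓ * (w₀ * (w₀ * 29 + 83) + 12) + 5) + (ℓ * (w₀ * 47 + 12) + 7)))) (Run.mono
      (run_bandwidthProg hin hn hw1 (by omega) fun p hp => ?_) le_rfl
      fun s₁ ⟨hin₁, hw, hww₀, hband⟩ => ?_)) ?_ fun _ => id
  · obtain ⟨h1, h2, h3, -⟩ := hlist p hp
    omega
  · generalize hw_def : s₁.ivar 3 = w at hw hww₀ hband
    have hle : ℓ * w ≤ ℓ * w₀ := Nat.mul_le_mul_left _ hww₀
    have hcov : ∀ i j : Fin ℓ, W i j ≠ 0 → ∃ p < n, s.iarr 0 p = i ∧ s.iarr 1 p = j := by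
      intro i j hne
      obtain ⟨p, ⟨hp, h1, h2⟩, -⟩ := hW.2 i j hne
      exact ⟨p, hp, h1, h2⟩
    -- The list contains every nonzero element of `W`, so the detected `w` is itself a valid
    -- bandwidth.
    have hbandW : ∀ i j : Fin ℓ, W i j ≠ 0 → (i : ℕ) < j + w := by
      intro i j hne
      obtain ⟨p, hp, h1, h2⟩ := hcov i j hne
      have := hband p hp
      rwa [h1, h2] at this
    have hrec := bandRecursion h hbandW
    refine Run.seq (Run.mono (run_zeroProg hin₁ hw_def hw hℓ (by omega)) (by omega)
      fun s₂ ⟨hin₂, h3, h0⟩ => Run.seq (Run.mono (run_scatterProg (E := entry W) hin₂ h3 hw hℓ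
        (by omega) hn h0 (fun p hp => ?_) fun i hi j hj hne => ?_) le_rfl
      fun s₃ ⟨hs₃, h3, hE⟩ => Run.seq (Run.mono (run_factorProg hrec hs₃ h3 hw hℓ (by omega)
        fun i hi b hb hbi => ⟨False.elim, fun _ => hE i hi b hb hbi⟩) ?_
      fun s₄ ⟨hs₄, h3, hf⟩ => Run.mono (run_emitProg hs₄ h3 hw hℓ (by omega) hf) ?_
      fun s₅ hl => storesSparse_of_lists h hbandW hl)))
    · obtain ⟨h1, h2, -, h4, -⟩ := hlist p hp
      exact ⟨h1, h2, hband p hp, h4⟩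
    · exact hcov ⟨i, hi⟩ ⟨j, hj⟩ (by simpa [entry, hi, hj] using hne)
    · gcongr
    · gcongr
  -- With `n ≤ 2 * (ℓ * w₀)` and every lower-order term bounded by `ℓ * (w₀ * w₀)`, the coefficients
  -- add up to 375.
  · have e1 : ℓ * (w₀ * (w₀ * 29 + 83) + 12) = 29 * (ℓ * (w₀ * w₀)) + 83 * (ℓ * w₀) + 12 * ℓ := by
      ring
    have e2 : ℓ * (w₀ * 47 + 12) = 47 * (ℓ * w₀) + 12 * ℓ := by ring
    rw [e1, e2]
    omega

end RealRAM

/-! ### The order of the bandwidth and the final estimates. -/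

namespace Vecchia

/-- An equidistant grid admits a bandwidth of the order `n ^ (1 - 1 / d) * m ^ (1 / d)`. -/
theorem exists_band {d ℓ m : ℕ} (hd : 1 ≤ d)
    {K : EuclideanSpace ℝ (Fin d) → EuclideanSpace ℝ (Fin d) → ℝ} {τ : ℝ}
    {S : Fin ℓ → EuclideanSpace ℝ (Fin d)} {q : Fin ℓ → Finset (Fin ℓ)}
    (hS : IsEquidistantGrid S) (hc : IsCoordOrdered S) (hm : 1 ≤ m)
    (hmℓ : (m : ℝ) ≤ (ℓ : ℝ) ^ (1 / (d : ℝ))) (hq : IsNearestNeighborConditioning S m q) :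
    1 ≤ ℓ ∧ ∃ w : ℕ, 1 ≤ w ∧ (∀ i j : Fin ℓ, matW K τ S q i j ≠ 0 → (i : ℕ) < j + w) ∧
      (w : ℝ) ≤ (2 * d + 1) * (((2 * ℓ : ℕ) : ℝ) ^ (1 - 1 / (d : ℝ)) * (m : ℝ) ^ (1 / (d : ℝ))) := by
  obtain ⟨N, a, h, e, hpos, hS⟩ := hS
  obtain ⟨c, hc⟩ := hc
  have hd0 : d ≠ 0 := by omega
  have hdR : (1 : ℝ) ≤ d := by exact_mod_cast hd
  have hmR : (1 : ℝ) ≤ m := by exact_mod_cast hm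
  have hcard : ℓ = N ^ d := by simpa using Fintype.card_congr e
  have hroot : (ℓ : ℝ) ^ (1 / (d : ℝ)) = N := by
    rw [hcard, Nat.cast_pow, one_div, Real.pow_rpow_inv_natCast (Nat.cast_nonneg N) hd0]
  have hmN : m ≤ N := by
    rw [hroot] at hmℓ
    exact_mod_cast hmℓ
  have hN : 1 ≤ N := hm.trans hmN
  have hNR : (0 : ℝ) < N := by exact_mod_cast hN
  have hℓ : 1 ≤ ℓ := hcard ▸ Nat.one_le_pow _ _ hN
  set μ : ℝ := (m : ℝ) ^ (1 / (d : ℝ)) with hμ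
  have hμ1 : 1 ≤ μ := Real.one_le_rpow hmR (by positivity)
  have hμm : μ ≤ m := by
    have h1 : 1 / (d : ℝ) ≤ 1 := (div_le_one (by positivity)).2 hdR
    exact (Real.rpow_le_rpow_of_exponent_le hmR h1).trans_eq (Real.rpow_one _)
  -- This is the least box side with `r ^ d ≥ m`. The assumption `m ≤ ℓ ^ (1/d) = N` makes the box
  -- fit into the grid, and `μ ≥ 1` gives `r ≤ 2 * μ`, so `d * r + 1 ≤ (2 * d + 1) * μ`.
  set r : ℕ := ⌈μ⌉₊ with hr
  have hrN : r ≤ N := (Nat.ceil_le.2 hμm).trans hmN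
  have hmr : m ≤ r ^ d := by
    have h1 : μ ^ d = m := by
      rw [hμ, one_div, Real.rpow_inv_natCast_pow (Nat.cast_nonneg m) hd0]
    have h2 : μ ^ d ≤ (r : ℝ) ^ d := pow_le_pow_left₀ (by positivity) (Nat.le_ceil μ) d
    rw [h1] at h2
    exact_mod_cast h2
  refine ⟨hℓ, (d * r + 1) * N ^ (d - 1), ?_,
    fun i j => matW_band hpos hS hc hq hrN hmr, ?_⟩
  · exact Nat.one_le_iff_ne_zero.2 (by positivity)
  · have hr2 : (r : ℝ) ≤ 2 * μ := by
      have := (Nat.ceil_lt_add_one (show 0 ≤ μ by positivity)).le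
      linarith
    have hexp : (0 : ℝ) ≤ 1 - 1 / (d : ℝ) := by
      have : 1 / (d : ℝ) ≤ 1 := (div_le_one (by positivity)).2 hdR
      linarith
    have hNℓ : ((N : ℝ)) ^ (d - 1) ≤ ((2 * ℓ : ℕ) : ℝ) ^ (1 - 1 / (d : ℝ)) := by
      have h1 : ((N : ℝ)) ^ (d - 1) = (ℓ : ℝ) ^ (1 - 1 / (d : ℝ)) := by
        rw [hcard, Nat.cast_pow, ← Real.rpow_natCast, ← Real.rpow_natCast, ← Real.rpow_mul hNR.le,
          Nat.cast_sub hd, mul_sub, mul_one_div_cancel (by positivity)]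
        simp
      rw [h1]
      refine Real.rpow_le_rpow (by positivity) ?_ hexp
      push_cast
      linarith [show (0 : ℝ) ≤ ℓ from Nat.cast_nonneg ℓ]
    push_cast
    push_cast at hNℓ
    calc ((d : ℝ) * r + 1) * (N : ℝ) ^ (d - 1)
        ≤ ((2 * d + 1) * μ) * (2 * (ℓ : ℝ)) ^ (1 - 1 / (d : ℝ)) := by
          refine mul_le_mul ?_ hNℓ (by positivity) (by positivity)
          nlinarith
      _ = _ := by ring

end Vecchia

theorem proposition5 :
    ∃ P : RealRAM.Prog, ∀ d : ℕ, 1 ≤ d → ∃ C : ℝ, 0 < C ∧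
      ∀ (ℓ m : ℕ) (D : Set (EuclideanSpace ℝ (Fin d)))
        (K : EuclideanSpace ℝ (Fin d) → EuclideanSpace ℝ (Fin d) → ℝ) (τ : ℝ)
        (S : Fin ℓ → EuclideanSpace ℝ (Fin d)) (q : Fin ℓ → Finset (Fin ℓ)),
        Vecchia.IsPosDefKernel D K → 0 < τ → (∀ i, S i ∈ D) →
        Vecchia.IsEquidistantGrid S → Vecchia.IsCoordOrdered S →
        1 ≤ m → (m : ℝ) ≤ (ℓ : ℝ) ^ (1 / (d : ℝ)) →
        Vecchia.IsNearestNeighborConditioning S m q →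
        -- `V` is the reverse Cholesky factor of `W`
        ((∀ i j, j < i → Vecchia.matV K τ S q i j = 0) ∧
          (∀ i, 0 < Vecchia.matV K τ S q i i) ∧
          Vecchia.matV K τ S q * (Vecchia.matV K τ S q).transpose = Vecchia.matW K τ S q) ∧
        -- nonzero elements in each column
        (∀ i, (Set.ncard {j | Vecchia.matV K τ S q j i ≠ 0} : ℝ) ≤
          C * ((2 * ℓ : ℕ) : ℝ) ^ (1 - 1 / (d : ℝ)) * (m : ℝ) ^ (1 / (d : ℝ))) ∧
        -- nonzero elements that have to be stored
        ((Set.ncard {p : Fin ℓ × Fin ℓ | Vecchia.matV K τ S q p.1 p.2 ≠ 0} : ℝ) ≤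
          C * ((2 * ℓ : ℕ) : ℝ) ^ (2 - 1 / (d : ℝ)) * (m : ℝ) ^ (1 / (d : ℝ))) ∧
        -- memory and time for the computation of `V` from `W`
        ∃ M : ℕ, (M : ℝ) ≤
            C * ((2 * ℓ : ℕ) : ℝ) ^ (2 - 1 / (d : ℝ)) * (m : ℝ) ^ (1 / (d : ℝ)) ∧
          ∀ s : RealRAM.State, s.ivar 0 = ℓ →
            RealRAM.StoresSparse s 1 0 1 0 (Vecchia.matW K τ S q) →
            ∃ (s' : RealRAM.State) (t : ℕ), RealRAM.Exec M P s s' t ∧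
              RealRAM.StoresSparse s' 2 2 3 1 (Vecchia.matV K τ S q) ∧
              (t : ℝ) ≤
                C * ((2 * ℓ : ℕ) : ℝ) ^ (3 - 2 / (d : ℝ)) * (m : ℝ) ^ (2 / (d : ℝ)) := by
  -- The time `400 * ℓ * w ^ 2` with `w ≤ (2 * d + 1) * X` dictates the constant, which also
  -- dominates the factor `2 * d + 1` needed for the counts and the memory.
  refine ⟨RealRAM.rcholProg, fun d hd => ⟨400 * (2 * d + 1) ^ 2, by positivity, ?_⟩⟩
  intro ℓ m D K τ S q hK hτ hSD hS hc hm hmℓ hq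
  have hV : Vecchia.IsRevCholeskyFactor (Vecchia.matW K τ S q) (Vecchia.matV K τ S q) :=
    Vecchia.isRevCholeskyFactor_rchol (Vecchia.posDef_matW hK hτ hSD)
  obtain ⟨hℓ, w, hw1, hband, hw⟩ := Vecchia.exists_band (K := K) (τ := τ) hd hS hc hm hmℓ hq
  have hn : (0 : ℝ) < ((2 * ℓ : ℕ) : ℝ) := by exact_mod_cast (by omega : 0 < 2 * ℓ)
  have hn2 : 2 * (ℓ : ℝ) = ((2 * ℓ : ℕ) : ℝ) := by push_cast; ring
  have hm0 : (0 : ℝ) < m := by exact_mod_cast hm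
  generalize ((2 * ℓ : ℕ) : ℝ) = n at hn hn2 hw ⊢
  -- With `X = n ^ (1 - 1/d) * m ^ (1/d)`, the three bounds are multiples of `X`, `n * X` and `n * X
  -- ^ 2`, and only `w ≤ (2 * d + 1) * X` remains to be used.
  have hX : 0 < n ^ (1 - 1 / (d : ℝ)) * (m : ℝ) ^ (1 / (d : ℝ)) := by positivity
  have htotal : n ^ (2 - 1 / (d : ℝ)) * (m : ℝ) ^ (1 / (d : ℝ)) =
      n * (n ^ (1 - 1 / (d : ℝ)) * (m : ℝ) ^ (1 / (d : ℝ))) := by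
    rw [show 2 - 1 / (d : ℝ) = 1 + (1 - 1 / (d : ℝ)) by ring, Real.rpow_add hn, Real.rpow_one,
      mul_assoc]
  have htime : n ^ (3 - 2 / (d : ℝ)) * (m : ℝ) ^ (2 / (d : ℝ)) =
      n * (n ^ (1 - 1 / (d : ℝ)) * (m : ℝ) ^ (1 / (d : ℝ))) ^ 2 := by
    rw [show 3 - 2 / (d : ℝ) = 1 + ((1 - 1 / (d : ℝ)) + (1 - 1 / (d : ℝ))) by ring,
      show 2 / (d : ℝ) = 1 / d + 1 / d by ring, Real.rpow_add hn, Real.rpow_add hn,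
      Real.rpow_add hm0, Real.rpow_one]
    ring
  simp only [mul_assoc (400 * (2 * (d : ℝ) + 1) ^ 2)]
  rw [htotal, htime]
  generalize n ^ (1 - 1 / (d : ℝ)) * (m : ℝ) ^ (1 / (d : ℝ)) = X at hX hw ⊢
  have hd1 : (1 : ℝ) ≤ 2 * d + 1 := by linarith [show (0 : ℝ) ≤ d from Nat.cast_nonneg d]
  have hC : 2 * (d : ℝ) + 1 ≤ 400 * (2 * d + 1) ^ 2 := by nlinarith
  have hwC : (w : ℝ) ≤ 400 * (2 * d + 1) ^ 2 * X := hw.trans (mul_le_mul_of_nonneg_right hC hX.le)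
  have hnw : n * w ≤ 400 * (2 * d + 1) ^ 2 * (n * X) := by
    calc n * w ≤ n * (400 * (2 * d + 1) ^ 2 * X) := mul_le_mul_of_nonneg_left hwC hn.le
      _ = _ := by ring
  refine ⟨⟨hV.upper, hV.diag_pos, hV.mul_transpose⟩, fun i => ?_, ?_, 2 * (ℓ * w), ?_, ?_⟩
  · exact le_trans (by exact_mod_cast hV.ncard_col_le hband i) hwC
  · have h1 : (Set.ncard {p : Fin ℓ × Fin ℓ | Vecchia.matV K τ S q p.1 p.2 ≠ 0} : ℝ) ≤ ℓ * w := by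
      exact_mod_cast hV.ncard_le hband
    have h2 : (0 : ℝ) ≤ ℓ * w := by positivity
    refine le_trans ?_ hnw
    rw [← hn2, mul_assoc]
    linarith
  · rw [Nat.cast_mul, Nat.cast_mul, Nat.cast_ofNat, ← mul_assoc, hn2]
    exact hnw
  · intro s hs hW
    obtain ⟨s', t, hexec, ht, hs'⟩ := RealRAM.run_rcholProg hV hband hw1 hℓ hs hW
    refine ⟨s', t, hexec, hs', ?_⟩
    have ht' : (t : ℝ) ≤ 400 * (ℓ * (w * w)) := by exact_mod_cast ht
    have hww : (w : ℝ) * w ≤ ((2 * d + 1) * X) * ((2 * d + 1) * X) :=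
      mul_le_mul hw hw (by positivity) (by positivity)
    calc (t : ℝ) ≤ 400 * (ℓ * (w * w)) := ht'
      _ ≤ 400 * (n * (((2 * d + 1) * X) * ((2 * d + 1) * X))) := by
        refine mul_le_mul_of_nonneg_left (mul_le_mul ?_ hww (by positivity) hn.le) (by norm_num)
        rw [← hn2]
        linarith [show (0 : ℝ) ≤ ℓ from Nat.cast_nonneg ℓ]
      _ = _ := by ring
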